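/- All sequences are real and indexed by $\mathbb N=\{1,2,\dots\}$ (with the counting measure). A Köthe sequence space is a Banach space $X$ of sequences such that $|x_n|\le |y_n|$ for all $n$ and $y\in X$ imply $x\in X$, $\|x\|_X\le\|y\|_X$, and which contains all finitely supported sequences. It is rearrangement invariant (r.i.) if, whenever $y\in X$ and $\#\{n:|x_n|>t\}=\#\{n:|y_n|>t\}$ for all $t\ge 0$, then $x\in X$ and $\|x\|_X=\|y\|_X$. It has the Fatou property if its closed unit ball is closed for coordinatewise convergence. An element $f$ of a normed ideal space $Z$ of sequences is order continuous if $\|f_k\|_Z\to0$ for all sequences $(f_k)$ in $Z$ with $0\le f_k\le|f|$ and $f_k\downarrow0$ coordinatewise; $Z_o$ is the set of these elements, and $Z$ is order continuous if $Z_o=Z$. Put $$M(X,Y)=\{f: fg\in Y\text{ for all }g\in X\},\qquad \|f\|_{M(X,Y)}=\sup_{\|g\|_X=1}\|fg\|_Y,$$ and $X\odot M(X,Y)=\{gh: g\in X,\ h\in M(X,Y)\}$ with the quasi-norm $\inf\{\|g\|_X\|h\|_{M(X,Y)}: f=gh\}$. For a bounded sequence $x$ let $\widetilde x_n=\sup_{m\ge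 n}|x_m|$ (for unbounded $x$ this is infinite), and let $(\mathscr Hx)_n=\frac1n\sum_{k=1}^n x_k$. The Tandori space is $\widetilde X=\{x:\widetilde x\in X\}$ with $\|x\|_{\widetilde X}=\|\widetilde x\|_X$; the Cesàro space is $CX=\{x:\mathscr H|x|\in X\}$ with $\|x\|_{CX}=\|\mathscr H|x|\|_X$. The essential norm $\|T\|_{ess}$ of a bounded operator is its distance to the compact operators in the operator norm. **Theorem.** Let $X$ and $Y$ be r.i. sequence spaces with the Fatou property. Suppose that $X$ is order continuous or $Y$ is reflexive, and that $X\odot M(X,Y)=Y$ (equality of sets, with equivalent quasi-norms). Then there are constants $c,C>0$, depending only on $X$ and $Y$, such that for every sequence $\lambda$ for which $M_\lambda:x\mapsto\lambda x$ is a bounded operator $\widetilde X\to\widetilde Y$, the sequence $\widetilde\lambda$ is finite and belongs to $M(X,Y)$, the limit below exists and is finite, and $$c\,\|M_\lambda:\widetilde X\to\widetilde Y\|_{ess}\le\lim_{n\to\infty}\|\widetilde\lambda\,\chi_{\{n,n+1,\dots\}}\|_{M(X,Y)}\le C\,\|M_\lambda:\widetilde X\to\widetilde Y\|_{ess}.$$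 Moreover, a sequence $\lambda$ defines a (bounded) compact multiplication operator $M_\lambda:\widetilde X\to\widetilde Y$ if and only if $\widetilde\lambda$ is finite and $\widetilde\lambda\in M(X,Y)_o$. If in addition $\mathscr H$ is bounded on $X$ and on $Y$, then the same statements (the two-sided estimate, with constants depending only on $X$ and $Y$, and the characterization of compactness) hold with $CX\to CY$ in place of $\widetilde X\to\widetilde Y$. -/

import Mathlib

open Filter Topology
open scoped ENNReal

noncomputable section

/-- A normed ideal space of real sequences (indexed by `ℕ = {0, 1, 2, …}` with counting measure),
given by its extended norm: the space consists of the sequences `x` with `N x < ∞`, and for those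
`N x` is the norm of `x`. Completeness is not part of this structure, see `SeqSpace.IsKothe`. -/
structure SeqSpace where
  /-- The norm, with the value `∞` at the sequences that do not belong to the space. -/
  N : (ℕ → ℝ) → ℝ≥0∞
  add_le' : ∀ x y, N (x + y) ≤ N x + N y
  smul' : ∀ (c : ℝ) x, N (c • x) = ‖c‖ₑ * N x
  eq_zero' : ∀ x, N x = 0 → x = 0
  mono' : ∀ x y, (∀ n, |x n| ≤ |y n|) → N x ≤ N y

namespace SeqSpace

/-- `x ∈ X`. -/
def Mem (X : SeqSpace) (x : ℕ → ℝ) : Prop := X.N x < ∞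

theorem enorm_abs_real (c : ℝ) : ‖|c|‖ₑ = ‖c‖ₑ := by
  rw [← Real.norm_eq_abs, enorm_norm]

theorem N_zero (X : SeqSpace) : X.N 0 = 0 := by
  have h := X.smul' 0 0
  simpa using h

/-- The linear space of all sequences that belong to `X`. -/
def space (X : SeqSpace) : Submodule ℝ (ℕ → ℝ) where
  carrier := {x | X.Mem x}
  add_mem' {x y} hx hy := lt_of_le_of_lt (X.add_le' x y) (ENNReal.add_lt_top.2 ⟨hx, hy⟩)
  zero_mem' := by simp [Mem, N_zero]
  smul_mem' c x hx := by
    have hx' : X.N x < ∞ := hx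
    show X.N (c • x) < ∞
    rw [X.smul']
    exact ENNReal.mul_lt_top enorm_lt_top hx'

/-- The normed space attached to `X`. This is a type of its own, so that it carries the norm
topology and not the topology of pointwise convergence. -/
def Elt (X : SeqSpace) : Type := X.space

instance (X : SeqSpace) : AddCommGroup X.Elt := inferInstanceAs (AddCommGroup X.space)

instance (X : SeqSpace) : Module ℝ X.Elt := inferInstanceAs (Module ℝ X.space)

/-- The sequence underlying an element of the normed space `X.Elt`. -/
def Elt.seq {X : SeqSpace} (x : X.Elt) : ℕ → ℝ := Subtype.val (p := fun y => y ∈ X.space) x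

instance (X : SeqSpace) : Norm X.Elt := ⟨fun x => (X.N x.seq).toReal⟩

theorem Elt.ne_top {X : SeqSpace} (x : X.Elt) : X.N x.seq ≠ ∞ :=
  (Subtype.property (p := fun y => y ∈ X.space) x).ne

theorem normCore (X : SeqSpace) : NormedSpace.Core ℝ X.Elt where
  norm_nonneg x := ENNReal.toReal_nonneg
  norm_smul c x := by
    show (X.N (c • x.seq)).toReal = ‖c‖ * (X.N x.seq).toReal
    rw [X.smul', ENNReal.toReal_mul, toReal_enorm]
  norm_triangle x y := by
    show (X.N (x.seq + y.seq)).toReal ≤ (X.N x.seq).toReal + (X.N y.seq).toReal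
    rw [← ENNReal.toReal_add x.ne_top y.ne_top]
    exact ENNReal.toReal_mono (ENNReal.add_ne_top.2 ⟨x.ne_top, y.ne_top⟩) (X.add_le' _ _)
  norm_eq_zero_iff x := by
    show (X.N x.seq).toReal = 0 ↔ x = 0
    constructor
    · intro h
      have h0 : X.N x.seq = 0 := by
        rcases (ENNReal.toReal_eq_zero_iff _).1 h with h | h
        · exact h
        · exact absurd h x.ne_top
      exact Subtype.ext (X.eq_zero' _ h0)
    · rintro rfl
      show (X.N 0).toReal = 0
      rw [X.N_zero, ENNReal.toReal_zero]

instance (X : SeqSpace) : NormedAddCommGroup X.Elt := NormedAddCommGroup.ofCore X.normCore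

instance (X : SeqSpace) : NormedSpace ℝ X.Elt := NormedSpace.ofCore X.normCore

/-- `X` is a Köthe sequence space (Banach ideal space over `ℕ` with the counting measure): it is
complete and contains the characteristic functions of all sets of finite measure. -/
structure IsKothe (X : SeqSpace) : Prop where
  complete : CompleteSpace X.Elt
  indicator_mem : ∀ s : Set ℕ, s.Finite → X.Mem (s.indicator 1)

/-- Two sequences are equimeasurable: `|x|` and `|y|` have the same distribution function with
respect to the counting measure. -/
def Equimeasurable (x y : ℕ → ℝ) : Prop :=
  ∀ t : ℝ, 0 ≤ t → {n | t < |x n|}.encard = {n | t < |y n|}.encard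

/-- `X` is a rearrangement invariant sequence space. -/
structure IsRI (X : SeqSpace) : Prop extends X.IsKothe where
  equimeasurable : ∀ x y, Equimeasurable x y → X.Mem y → X.Mem x ∧ X.N x = X.N y

/-- The Fatou property: the closed unit ball is closed for local convergence in measure, which
over `ℕ` with the counting measure is pointwise convergence. -/
def HasFatou (X : SeqSpace) : Prop := IsClosed {x : ℕ → ℝ | X.N x ≤ 1}

/-- `f` is order continuous for the (extended) norm `N`. -/
def IsOCElement (N : (ℕ → ℝ) → ℝ≥0∞) (f : ℕ → ℝ) : Prop :=
  ∀ u : ℕ → ℕ → ℝ, (∀ k n, 0 ≤ u k n) → (∀ k n, u k n ≤ |f n|) → (∀ n, Antitone fun k => u k n) →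
    (∀ n, Tendsto (fun k => u k n) atTop (𝓝 0)) → Tendsto (fun k => N (u k)) atTop (𝓝 0)

/-- `X` is order continuous: `X = X_o`. -/
def IsOC (X : SeqSpace) : Prop := ∀ f, X.Mem f → IsOCElement X.N f

/-- `X` is reflexive: the canonical embedding into the bidual is onto. -/
def IsReflexive (X : SeqSpace) : Prop :=
  Function.Surjective (NormedSpace.inclusionInDoubleDual ℝ X.Elt)

/-! ### Pointwise multipliers and pointwise products -/

/-- `f ∈ M(X, Y)`. -/
def MultMem (X Y : SeqSpace) (f : ℕ → ℝ) : Prop := ∀ g, X.Mem g → Y.Mem (f * g)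

/-- The norm of `M(X, Y)`. -/
def multNorm (X Y : SeqSpace) (f : ℕ → ℝ) : ℝ≥0∞ :=
  ⨆ (g : ℕ → ℝ) (_ : X.N g = 1), Y.N (f * g)

/-- `f ∈ M(X, Y)_o`. -/
def MultOCMem (X Y : SeqSpace) (f : ℕ → ℝ) : Prop :=
  MultMem X Y f ∧ IsOCElement (multNorm X Y) f

/-- `f ∈ X ⊙ M(X, Y)`. -/
def ProdMem (X Y : SeqSpace) (f : ℕ → ℝ) : Prop :=
  ∃ g h, X.Mem g ∧ MultMem X Y h ∧ f = g * h

/-- The quasi-norm of `X ⊙ M(X, Y)`. -/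
def prodNorm (X Y : SeqSpace) (f : ℕ → ℝ) : ℝ≥0∞ :=
  ⨅ (g : ℕ → ℝ) (h : ℕ → ℝ) (_ : X.Mem g ∧ MultMem X Y h ∧ f = g * h), X.N g * multNorm X Y h

/-- `X ⊙ M(X, Y) = Y`: equality of the underlying sets, with equivalence of the (quasi-)norms. -/
def Factorizes (X Y : SeqSpace) : Prop :=
  (∀ f, ProdMem X Y f ↔ Y.Mem f) ∧
  ∃ c C : ℝ, 0 < c ∧ 0 < C ∧ ∀ f, Y.Mem f →
    ENNReal.ofReal c * Y.N f ≤ prodNorm X Y f ∧ prodNorm X Y f ≤ ENNReal.ofReal C * Y.N f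

/-! ### Cesàro and Tandori spaces -/

/-- The discrete Hardy operator; the term with index `n` is the mean of the first `n + 1` terms. -/
def hardy (x : ℕ → ℝ) (n : ℕ) : ℝ := (∑ k ∈ Finset.range (n + 1), x k) / (n + 1)

/-- The discrete Hardy operator is bounded on `X`. -/
def HardyBounded (X : SeqSpace) : Prop :=
  ∃ K : ℝ, 0 ≤ K ∧ ∀ x, X.Mem x → X.N (hardy x) ≤ ENNReal.ofReal K * X.N x

theorem hardy_nonneg {x : ℕ → ℝ} (hx : ∀ n, 0 ≤ x n) (n : ℕ) : 0 ≤ hardy x n := by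
  unfold hardy
  have := Finset.sum_nonneg (s := Finset.range (n + 1)) (fun k _ => hx k)
  positivity

theorem hardy_mono {x y : ℕ → ℝ} (hxy : ∀ n, x n ≤ y n) (n : ℕ) : hardy x n ≤ hardy y n := by
  unfold hardy
  have := Finset.sum_le_sum (s := Finset.range (n + 1)) (fun k _ => hxy k)
  gcongr

/-- The Cesàro sequence space `CX`, with the norm `‖x‖ = ‖H |x|‖_X`. -/
def cesaro (X : SeqSpace) : SeqSpace where
  N x := X.N (hardy fun k => |x k|)
  add_le' x y := by
    refine le_trans (X.mono' _ ((hardy fun k => |x k|) + hardy fun k => |y k|) fun n => ?_)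
      (X.add_le' _ _)
    refine abs_le_abs_of_nonneg (hardy_nonneg (fun k => abs_nonneg _) n) ?_
    have h : ((hardy fun k => |x k|) + hardy fun k => |y k|) n
        = hardy (fun k => |x k| + |y k|) n := by
      simp [hardy, Finset.sum_add_distrib, add_div]
    rw [h]
    exact hardy_mono (fun k => abs_add_le _ _) n
  smul' c x := by
    have h : (hardy fun k => |(c • x) k|) = |c| • hardy fun k => |x k| := by
      funext n
      simp [hardy, abs_mul, ← Finset.mul_sum, mul_div_assoc]
    rw [h, X.smul', enorm_abs_real]
  eq_zero' x hx := by
    have h := X.eq_zero' _ hx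
    funext n
    have hn : hardy (fun k => |x k|) n = 0 := congrFun h n
    unfold hardy at hn
    have hpos : ((n : ℝ) + 1) ≠ 0 := by positivity
    have hs := (div_eq_zero_iff.1 hn).resolve_right hpos
    have := (Finset.sum_eq_zero_iff_of_nonneg (fun k _ => abs_nonneg (x k))).1 hs n (by simp)
    simpa using this
  mono' x y hxy := by
    refine X.mono' _ _ fun n => ?_
    exact abs_le_abs_of_nonneg (hardy_nonneg (fun k => abs_nonneg _) n) (hardy_mono hxy n)

/-- `x` is a bounded sequence; these are the sequences whose non-increasing majorant is finite. -/
def Bdd (x : ℕ → ℝ) : Prop := BddAbove (Set.range fun n => |x n|)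

/-- The non-increasing majorant `n ↦ sup_{m ≥ n} |x m|` of a bounded sequence. -/
def majorant (x : ℕ → ℝ) (n : ℕ) : ℝ := ⨆ k : ℕ, |x (n + k)|

theorem Bdd.tail {x : ℕ → ℝ} (hx : Bdd x) (n : ℕ) :
    BddAbove (Set.range fun k => |x (n + k)|) := by
  obtain ⟨B, hB⟩ := hx
  refine ⟨B, ?_⟩
  rintro _ ⟨k, rfl⟩
  exact hB ⟨n + k, rfl⟩

theorem majorant_nonneg (x : ℕ → ℝ) (n : ℕ) : 0 ≤ majorant x n :=
  Real.iSup_nonneg fun _ => abs_nonneg _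

theorem le_majorant {x : ℕ → ℝ} (hx : Bdd x) (n : ℕ) : |x n| ≤ majorant x n :=
  le_ciSup (hx.tail n) 0

theorem majorant_mono {x y : ℕ → ℝ} (hy : Bdd y) (hxy : ∀ n, |x n| ≤ |y n|) (n : ℕ) :
    majorant x n ≤ majorant y n :=
  ciSup_mono (hy.tail n) fun k => hxy (n + k)

theorem Bdd.mono {x y : ℕ → ℝ} (hy : Bdd y) (hxy : ∀ n, |x n| ≤ |y n|) : Bdd x := by
  obtain ⟨B, hB⟩ := hy
  refine ⟨B, ?_⟩
  rintro _ ⟨k, rfl⟩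
  exact (hxy k).trans (hB ⟨k, rfl⟩)

theorem Bdd.add {x y : ℕ → ℝ} (hx : Bdd x) (hy : Bdd y) : Bdd (x + y) := by
  obtain ⟨A, hA⟩ := hx
  obtain ⟨B, hB⟩ := hy
  refine ⟨A + B, ?_⟩
  rintro _ ⟨k, rfl⟩
  exact (abs_add_le (x k) (y k)).trans (add_le_add (hA ⟨k, rfl⟩) (hB ⟨k, rfl⟩))

theorem Bdd.smul {x : ℕ → ℝ} (c : ℝ) (hx : Bdd x) : Bdd (c • x) := by
  obtain ⟨A, hA⟩ := hx
  refine ⟨|c| * A, ?_⟩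
  rintro _ ⟨k, rfl⟩
  show |c * x k| ≤ |c| * A
  rw [abs_mul]
  exact mul_le_mul_of_nonneg_left (hA ⟨k, rfl⟩) (abs_nonneg c)

theorem majorant_smul (c : ℝ) (x : ℕ → ℝ) : majorant (c • x) = |c| • majorant x := by
  funext n
  simp only [majorant, Pi.smul_apply, smul_eq_mul, abs_mul]
  rw [Real.mul_iSup_of_nonneg (abs_nonneg c)]

open Classical in
/-- The Tandori sequence space of all `x` whose non-increasing majorant is (finite and) in `X`,
with the norm of the majorant in `X`. -/
def tandori (X : SeqSpace) : SeqSpace where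
  N x := if Bdd x then X.N (majorant x) else ∞
  add_le' x y := by
    by_cases hx : Bdd x
    · by_cases hy : Bdd y
      · rw [if_pos hx, if_pos hy, if_pos (hx.add hy)]
        refine le_trans (X.mono' _ (majorant x + majorant y) fun n => ?_) (X.add_le' _ _)
        refine abs_le_abs_of_nonneg (majorant_nonneg _ n) ?_
        refine ciSup_le fun k => (abs_add_le (x (n + k)) (y (n + k))).trans ?_
        exact add_le_add (le_ciSup (hx.tail n) k) (le_ciSup (hy.tail n) k)
      · simp [if_neg hy]
    · simp [if_neg hx]
  smul' c x := by
    by_cases hx : Bdd x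
    · rw [if_pos hx, if_pos (hx.smul c), majorant_smul, X.smul', enorm_abs_real]
    · by_cases hc : c = 0
      · subst hc
        have h : Bdd (0 : ℕ → ℝ) := ⟨0, by rintro _ ⟨k, rfl⟩; simp⟩
        have h0 : majorant (0 : ℕ → ℝ) = 0 := by funext n; simp [majorant]
        simp [h, h0, X.N_zero]
      · have h : ¬ Bdd (c • x) := fun h => hx (by
          have := h.smul c⁻¹
          rwa [smul_smul, inv_mul_cancel₀ hc, one_smul] at this)
        rw [if_neg hx, if_neg h, ENNReal.mul_top (by simpa using hc)]
  eq_zero' x hx := by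
    by_cases h : Bdd x
    · rw [if_pos h] at hx
      have h0 := X.eq_zero' _ hx
      funext n
      have := le_majorant h n
      rw [h0] at this
      simpa using this
    · simp [if_neg h] at hx
  mono' x y hxy := by
    by_cases hy : Bdd y
    · rw [if_pos hy, if_pos (hy.mono hxy)]
      exact X.mono' _ _ fun n =>
        abs_le_abs_of_nonneg (majorant_nonneg _ n) (majorant_mono hy hxy n)
    · simp [if_neg hy]

/-! ### Multiplication operators and essential norms -/

/-- The bounded linear operator `T : X → Y` is the multiplication operator `x ↦ l x`. -/
def IsMulOp {X Y : SeqSpace} (l : ℕ → ℝ) (T : X.Elt →L[ℝ] Y.Elt) : Prop :=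
  ∀ x : X.Elt, (T x).seq = l * x.seq

/-- The essential norm of `T`: its distance, in operator norm, to the compact operators. -/
def essNorm {X Y : SeqSpace} (T : X.Elt →L[ℝ] Y.Elt) : ℝ :=
  sInf {r : ℝ | ∃ K : X.Elt →L[ℝ] Y.Elt, IsCompactOperator K ∧ r = ‖T - K‖}

/-- The truncation `x χ_{n, n+1, …}`. -/
def tail (x : ℕ → ℝ) (n : ℕ) : ℕ → ℝ := (Set.Ici n).indicator x

/-- `E` and `F` are sequence spaces derived from `X` and `Y`. For all bounded multiplication
operators `M_l : E → F`, the majorant of `l` belongs to `M(X, Y)`, the norms in `M(X, Y)` of its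
truncations converge to a finite limit, and this limit is equivalent to the essential norm of
`M_l : E → F`, with constants that do not depend on `l`. -/
def EssNormEquivalence (X Y E F : SeqSpace) : Prop :=
  ∃ c C : ℝ, 0 < c ∧ 0 < C ∧ ∀ (l : ℕ → ℝ) (T : E.Elt →L[ℝ] F.Elt), IsMulOp l T →
    Bdd l ∧ MultMem X Y (majorant l) ∧
    ∃ L : ℝ, Tendsto (fun n => multNorm X Y (tail (majorant l) n)) atTop (𝓝 (ENNReal.ofReal L)) ∧
      c * essNorm T ≤ L ∧ L ≤ C * essNorm T

/-- For every sequence `l`, multiplication by `l` is a (well defined, bounded and) compact operator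
`E → F` if and only if the majorant of `l` is finite and belongs to `M(X, Y)_o`. -/
def CompactnessCriterion (X Y E F : SeqSpace) : Prop :=
  ∀ l : ℕ → ℝ, (∃ T : E.Elt →L[ℝ] F.Elt, IsMulOp l T ∧ IsCompactOperator T) ↔
    Bdd l ∧ MultOCMem X Y (majorant l)

end SeqSpace

end

namespace SeqSpace

/-! ### Symmetric lattice norms in finite dimensions -/

/-! Everything rests on one inequality, `exists_multNorm_majorant_le`: if the majorant of `l * g`
has `Y`-norm at most `B` times the `X`-norm of `g`, for finitely supported decreasing `g ≥ 0` and
all truncations of `l`, then the majorant of `l` has norm at most a constant times `B` in `M(X, Y)`.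
By the Fatou property `l` may be taken finitely supported, and the problem becomes
finite-dimensional (`exists_antitone_multiplier`). It is solved by a logarithmic variational
argument in the spirit of Lozanovskii factorization. Let `u` be the majorant of `l`, `h` a norming
functional for `u` in `M(X, Y)`, and `w = h u / ‖u‖` the resulting probability weights. On positive
vectors, `Λ f = ∑ w log f` is maximal at `u` on the sphere of `M(X, Y)` through `u`; let `g`
maximize it up to `1` on the unit ball of `X`. Factoring `u g` through `X ⊙ M(X, Y)` and comparing
the values of `Λ` gives `‖u‖ ≤ e C ‖u g‖_Y`. Symmetry of the norms allows `g` to be decreasing and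
constant on the level sets of `u`; as `|l|` attains its majorant at the end of each level set, `u g`
is then dominated by the majorant of `l g`.

For Tandori spaces the converse bound is the pointwise estimate of the majorant of `l x` by the
product of the majorants. For Cesàro spaces, one direction moves the mass of `g` to the places where
`l g` attains its majorant (`exists_moved_mass`), and the other combines Abel summation with the
boundedness of the Hardy operator on `Y` (`cesaro_mul_le`).

The passage to essential norms (`essNorm_and_compactness`) is common to both cases. Truncations of
the symbol give finite rank operators, hence the upper bound. Conversely, order continuity of the
target makes the tails of any limit of images under a compact operator vanish, so subtracting such
an operator cannot help on far tails. Order continuity of `Y` comes from `Factorizes.isOC` or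
`IsReflexive.isOC`. -/

/-- A permutation invariant lattice norm on `ℝⁿ`. -/
structure IsSymmNorm {n : ℕ} (p : (Fin n → ℝ) → ℝ) : Prop where
  add_le : ∀ x y, p (x + y) ≤ p x + p y
  smul : ∀ (c : ℝ) x, p (c • x) = |c| * p x
  mono : ∀ x y, (∀ i, |x i| ≤ |y i|) → p x ≤ p y
  perm : ∀ (σ : Equiv.Perm (Fin n)) x, p (x ∘ σ) ≤ p x
  pos : ∀ x, x ≠ 0 → 0 < p x

theorem IsSymmNorm.zero {n : ℕ} {p : (Fin n → ℝ) → ℝ} (hp : IsSymmNorm p) : p 0 = 0 := by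
  simpa using hp.smul 0 0

theorem IsSymmNorm.nonneg {n : ℕ} {p : (Fin n → ℝ) → ℝ} (hp : IsSymmNorm p) (x : Fin n → ℝ) :
    0 ≤ p x := by
  by_cases h : x = 0
  · rw [h, hp.zero]
  · exact (hp.pos x h).le

theorem IsSymmNorm.sum_le {n : ℕ} {p : (Fin n → ℝ) → ℝ} (hp : IsSymmNorm p) {ι : Type*}
    (s : Finset ι) (f : ι → Fin n → ℝ) : p (∑ i ∈ s, f i) ≤ ∑ i ∈ s, p (f i) := by
  classical
  induction s using Finset.induction_on with
  | empty => simp [hp.zero]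
  | insert a s ha ih =>
    rw [Finset.sum_insert ha, Finset.sum_insert ha]
    exact (hp.add_le _ _).trans (add_le_add le_rfl ih)

theorem exists_antitone_comp_perm {n : ℕ} (f : Fin n → ℝ) :
    ∃ σ : Equiv.Perm (Fin n), Antitone (f ∘ σ) := by
  refine ⟨Tuple.sort (fun i => -f i), fun i j hij => ?_⟩
  simpa using Tuple.monotone_sort (fun i => -f i) hij

/-- The permutations of the indices that leave `u` unchanged. -/
noncomputable def stabPerms {n : ℕ} (u : Fin n → ℝ) : Finset (Equiv.Perm (Fin n)) :=
  Finset.univ.filter fun σ => u ∘ σ = u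

theorem mem_stabPerms {n : ℕ} {u : Fin n → ℝ} {σ : Equiv.Perm (Fin n)} :
    σ ∈ stabPerms u ↔ ∀ i, u (σ i) = u i := by
  simp [stabPerms, funext_iff]

theorem stabPerms_card_pos {n : ℕ} (u : Fin n → ℝ) : (0 : ℝ) < (stabPerms u).card := by
  have : (1 : Equiv.Perm (Fin n)) ∈ stabPerms u := mem_stabPerms.2 fun i => rfl
  exact_mod_cast Finset.card_pos.2 ⟨_, this⟩

/-- The conditional expectation on the level sets of `u`. -/
noncomputable def levelAvg {n : ℕ} (u f : Fin n → ℝ) : Fin n → ℝ :=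
  ((stabPerms u).card : ℝ)⁻¹ • ∑ σ ∈ stabPerms u, f ∘ σ

theorem levelAvg_apply {n : ℕ} (u f : Fin n → ℝ) (i : Fin n) :
    levelAvg u f i = ((stabPerms u).card : ℝ)⁻¹ * ∑ σ ∈ stabPerms u, f (σ i) := by
  simp [levelAvg, Finset.sum_apply]

/-- The transposition of `i` and `j` stabilizes `u`, and right multiplication by it permutes the
stabilizer. -/
theorem levelAvg_congr {n : ℕ} (u f : Fin n → ℝ) {i j : Fin n} (h : u i = u j) :
    levelAvg u f i = levelAvg u f j := by
  rw [levelAvg_apply, levelAvg_apply]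
  congr 1
  have hs : ∀ k, u (Equiv.swap i j k) = u k := fun k => by
    rcases eq_or_ne k i with rfl | hi
    · rw [Equiv.swap_apply_left, h]
    · rcases eq_or_ne k j with rfl | hj
      · rw [Equiv.swap_apply_right, h]
      · rw [Equiv.swap_apply_of_ne_of_ne hi hj]
  refine Finset.sum_nbij' (fun σ => σ * Equiv.swap i j) (fun σ => σ * Equiv.swap i j) ?_ ?_ ?_ ?_ ?_
  · intro σ hσ
    exact mem_stabPerms.2 fun k => by rw [Equiv.Perm.mul_apply, mem_stabPerms.1 hσ, hs]
  · intro σ hσ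
    exact mem_stabPerms.2 fun k => by rw [Equiv.Perm.mul_apply, mem_stabPerms.1 hσ, hs]
  · intro σ _; simp [mul_assoc]
  · intro σ _; simp [mul_assoc]
  · intro σ _; simp

theorem levelAvg_pos {n : ℕ} (u : Fin n → ℝ) {f : Fin n → ℝ} (hf : ∀ i, 0 < f i) (i : Fin n) :
    0 < levelAvg u f i := by
  rw [levelAvg_apply]
  have h1 : (1 : Equiv.Perm (Fin n)) ∈ stabPerms u := mem_stabPerms.2 fun i => rfl
  exact mul_pos (inv_pos.2 (stabPerms_card_pos u)) (Finset.sum_pos (fun σ _ => hf _) ⟨_, h1⟩)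

theorem levelAvg_nonneg {n : ℕ} (u : Fin n → ℝ) {f : Fin n → ℝ} (hf : ∀ i, 0 ≤ f i) (i : Fin n) :
    0 ≤ levelAvg u f i := by
  rw [levelAvg_apply]
  exact mul_nonneg (inv_nonneg.2 (stabPerms_card_pos u).le) (Finset.sum_nonneg fun σ _ => hf _)

/-- The level sets of a decreasing `u` are consecutive intervals, so a permutation preserving them
keeps the order of indices from different levels. -/
theorem levelAvg_antitone {n : ℕ} {u f : Fin n → ℝ} (hu : Antitone u) (hf : Antitone f) :
    Antitone (levelAvg u f) := by
  intro i j hij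
  rcases eq_or_ne (u i) (u j) with h | h
  · exact (levelAvg_congr u f h).ge
  · rw [levelAvg_apply, levelAvg_apply]
    refine mul_le_mul_of_nonneg_left (Finset.sum_le_sum fun σ hσ => hf ?_)
      (inv_nonneg.2 (stabPerms_card_pos u).le)
    by_contra hlt
    have := hu (le_of_not_ge hlt)
    rw [mem_stabPerms.1 hσ, mem_stabPerms.1 hσ] at this
    exact h (le_antisymm this (hu hij))

theorem IsSymmNorm.levelAvg_le {n : ℕ} {p : (Fin n → ℝ) → ℝ} (hp : IsSymmNorm p)
    (u f : Fin n → ℝ) : p (levelAvg u f) ≤ p f := by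
  have hc := stabPerms_card_pos u
  rw [levelAvg, hp.smul, abs_of_pos (inv_pos.2 hc), inv_mul_le_iff₀ hc]
  refine (hp.sum_le _ _).trans ((Finset.sum_le_sum fun σ _ => hp.perm σ f).trans ?_)
  rw [Finset.sum_const, nsmul_eq_mul]

theorem sum_mul_levelAvg {n : ℕ} (u f : Fin n → ℝ) {w : Fin n → ℝ}
    (hw : ∀ σ ∈ stabPerms u, ∀ i, w (σ i) = w i) :
    ∑ i, w i * levelAvg u f i = ∑ i, w i * f i := by
  have hc := stabPerms_card_pos u
  have h : ∑ i, w i * levelAvg u f i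
      = ((stabPerms u).card : ℝ)⁻¹ * ∑ σ ∈ stabPerms u, ∑ i, w i * f (σ i) := by
    rw [Finset.sum_comm, Finset.mul_sum]
    refine Finset.sum_congr rfl fun i _ => ?_
    rw [levelAvg_apply, ← Finset.mul_sum]
    ring
  rw [h, Finset.sum_congr rfl (g := fun _ => ∑ i, w i * f i), Finset.sum_const, nsmul_eq_mul,
    inv_mul_cancel_left₀ hc.ne']
  intro σ hσ
  rw [← Equiv.sum_comp σ (fun i => w i * f i)]
  exact Finset.sum_congr rfl fun i _ => by rw [hw σ hσ]

/-- Jensen's inequality for the concave logarithm. -/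
theorem levelAvg_log_le {n : ℕ} (u : Fin n → ℝ) {f : Fin n → ℝ} (hf : ∀ i, 0 < f i) (i : Fin n) :
    levelAvg u (fun j => Real.log (f j)) i ≤ Real.log (levelAvg u f i) := by
  have hc := stabPerms_card_pos u
  rw [levelAvg_apply, levelAvg_apply]
  have := strictConcaveOn_log_Ioi.concaveOn.le_map_sum (t := stabPerms u)
    (w := fun _ => ((stabPerms u).card : ℝ)⁻¹) (p := fun σ => f (σ i))
    (fun _ _ => (inv_pos.2 hc).le)
    (by rw [Finset.sum_const, nsmul_eq_mul, mul_inv_cancel₀ hc.ne']) (fun σ _ => hf _)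
  simpa [Finset.mul_sum] using this

theorem sum_mul_le_sum_mul_comp_perm {n : ℕ} {w f : Fin n → ℝ} {σ : Equiv.Perm (Fin n)}
    (hw : Antitone w) (hf : Antitone (f ∘ σ)) : ∑ i, w i * f i ≤ ∑ i, w i * f (σ i) := by
  have hm : Monovary w (f ∘ σ) := by
    intro i j hij
    refine hw ?_
    by_contra h
    exact absurd (hf (le_of_not_ge h)) (not_le.2 hij)
  simpa using hm.sum_mul_comp_perm_le_sum_mul (σ := σ⁻¹)

/-- A norming functional at a positive decreasing vector that is itself decreasing, and constant
on the level sets of that vector. -/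
theorem IsSymmNorm.exists_norming {n : ℕ} {m : (Fin n → ℝ) → ℝ} (hm : IsSymmNorm m)
    {u : Fin n → ℝ} (hu : Antitone u) (hu0 : ∀ i, 0 < u i) (hn : 0 < n) :
    ∃ h : Fin n → ℝ, Antitone h ∧ (∀ i, 0 ≤ h i) ∧ (∀ i j, u i = u j → h i = h j) ∧
      ∑ i, h i * u i = m u ∧ ∀ f, (∀ i, 0 ≤ f i) → ∑ i, h i * f i ≤ m f := by
  have hune : u ≠ 0 := fun h => (hu0 ⟨0, hn⟩).ne' (congrFun h _)
  -- Hahn–Banach extension of `c u ↦ c m(u)`, dominated by `m`.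
  obtain ⟨φ, hφu, hφ⟩ := exists_extension_of_le_sublinear
    (LinearPMap.mkSpanSingleton u (m u) hune : (Fin n → ℝ) →ₗ.[ℝ] ℝ) m
    (fun c hc x => by rw [hm.smul, abs_of_pos hc]) hm.add_le (by
      rintro ⟨x, hx⟩
      obtain ⟨c, rfl⟩ := Submodule.mem_span_singleton.1 hx
      have : (LinearPMap.mkSpanSingleton u (m u) hune : (Fin n → ℝ) →ₗ.[ℝ] ℝ) ⟨c • u, hx⟩ = c • m u :=
        LinearPMap.mkSpanSingleton'_apply _ _ _ _ _
      rw [this, hm.smul, smul_eq_mul]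
      exact mul_le_mul_of_nonneg_right (le_abs_self c) (hm.nonneg _))
  have hφu' : φ u = m u := by
    have h1 := hφu ⟨u, Submodule.mem_span_singleton_self u⟩
    have h2 : (LinearPMap.mkSpanSingleton u (m u) hune : (Fin n → ℝ) →ₗ.[ℝ] ℝ)
        ⟨u, Submodule.mem_span_singleton_self u⟩ = m u :=
      LinearPMap.mkSpanSingleton_apply ℝ ℝ hune (m u)
    exact h1.trans h2
  have hsum : ∀ f, φ f = ∑ i, f i * φ (Pi.single i 1) := fun f => by
    rw [LinearMap.pi_apply_eq_sum_univ φ f]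
    refine Finset.sum_congr rfl fun i _ => ?_
    rw [smul_eq_mul]
    congr 2
    funext j
    simp [Pi.single_apply, eq_comm]
  -- Passing to absolute values keeps the domination by `m`, since signs can be absorbed into the
  -- argument of a lattice norm.
  set a : Fin n → ℝ := fun i => |φ (Pi.single i 1)| with ha
  have ha0 : ∀ i, 0 ≤ a i := fun i => abs_nonneg _
  have haf : ∀ f, (∀ i, 0 ≤ f i) → ∑ i, a i * f i ≤ m f := by
    intro f hf
    have h1 : ∑ i, a i * f i = φ (fun i => SignType.sign (φ (Pi.single i 1)) * f i) := by
      rw [hsum]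
      refine Finset.sum_congr rfl fun i _ => ?_
      rw [ha]
      simp only
      rw [← sign_mul_self]
      ring
    rw [h1]
    refine (hφ _).trans (hm.mono _ _ fun i => ?_)
    rw [abs_mul]
    refine mul_le_of_le_one_left (abs_nonneg _) ?_
    rcases SignType.sign (φ (Pi.single i 1)) with _ | _ | _ <;> simp
  -- Sorting the coefficients and averaging them over the stabilizer of `u` preserves the
  -- domination, as `m` is symmetric. The value at `u` does not drop: sorting can only raise it, and
  -- averaging leaves it unchanged.
  obtain ⟨σ, hσ⟩ := exists_antitone_comp_perm a
  have hle : ∀ f, (∀ i, 0 ≤ f i) → ∑ i, levelAvg u (a ∘ σ) i * f i ≤ m f := by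
    intro f hf
    have h1 : ∀ τ : Equiv.Perm (Fin n), ∑ i, a (τ i) * f i ≤ m f := by
      intro τ
      rw [← Equiv.sum_comp τ⁻¹]
      refine le_trans (le_of_eq ?_) ((haf (f ∘ (τ⁻¹ : Equiv.Perm (Fin n))) fun i => hf _).trans
        (hm.perm _ _))
      simp
    have hc := stabPerms_card_pos u
    have h2 : ∑ i, levelAvg u (a ∘ σ) i * f i
        = ((stabPerms u).card : ℝ)⁻¹ * ∑ τ ∈ stabPerms u, ∑ i, a ((σ * τ) i) * f i := by
      rw [Finset.sum_comm, Finset.mul_sum]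
      refine Finset.sum_congr rfl fun i _ => ?_
      rw [levelAvg_apply, ← Finset.sum_mul]
      simp [mul_assoc]
    rw [h2, inv_mul_le_iff₀ hc]
    refine (Finset.sum_le_sum fun τ _ => h1 (σ * τ)).trans ?_
    rw [Finset.sum_const, nsmul_eq_mul]
  refine ⟨levelAvg u (a ∘ σ), levelAvg_antitone hu hσ, levelAvg_nonneg u fun i => ha0 _,
    fun i j h => levelAvg_congr u _ h, le_antisymm (hle u fun i => (hu0 i).le) ?_, hle⟩
  rw [← hφu', hsum, Finset.sum_congr rfl fun i _ => mul_comm (levelAvg u (a ∘ σ) i) (u i),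
    sum_mul_levelAvg u _ (fun τ hτ => mem_stabPerms.1 hτ)]
  refine le_trans (Finset.sum_le_sum fun i _ => ?_) (sum_mul_le_sum_mul_comp_perm hu hσ)
  exact mul_le_mul_of_nonneg_left (le_abs_self _) (hu0 i).le

/-- If every vector factors through `p` and `m`, then the `m`-norm of a decreasing vector `u` is
controlled by the `q`-norm of `u g` for a decreasing `g` that is constant on the level
sets of `u`. -/
theorem exists_antitone_multiplier {n : ℕ} {p m : (Fin n → ℝ) → ℝ} {q : (Fin n → ℝ) → ℝ}
    (hp : IsSymmNorm p) (hm : IsSymmNorm m) {C : ℝ}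
    (hfac : ∀ z, (∀ i, 0 < z i) →
      ∃ g f : Fin n → ℝ, (∀ i, z i = g i * f i) ∧ p g * m f ≤ C * q z)
    {u : Fin n → ℝ} (hu : Antitone u) (hu0 : ∀ i, 0 < u i) (hn : 0 < n) :
    ∃ g : Fin n → ℝ, Antitone g ∧ (∀ i, 0 < g i) ∧ (∀ i j, u i = u j → g i = g j) ∧ p g ≤ 1 ∧
      m u ≤ Real.exp 1 * C * q (u * g) := by
  obtain ⟨h, hha, hh0, hhc, hhu, hhf⟩ := hm.exists_norming hu hu0 hn
  have hne : ∀ f : Fin n → ℝ, (∀ i, 0 < f i) → f ≠ 0 := fun f hf h0 =>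
    (hf ⟨0, hn⟩).ne' (congrFun h0 _)
  have hL : 0 < m u := hm.pos _ (hne u hu0)
  set w : Fin n → ℝ := fun i => h i * u i / m u with hw
  have hw0 : ∀ i, 0 ≤ w i := fun i => div_nonneg (mul_nonneg (hh0 i) (hu0 i).le) hL.le
  have hw1 : ∑ i, w i = 1 := by
    rw [hw, ← Finset.sum_div, hhu, div_self hL.ne']
  have hwa : Antitone w := fun i j hij => by
    refine div_le_div_of_nonneg_right ?_ hL.le
    exact mul_le_mul (hha hij) (hu hij) (hu0 j).le (hh0 i)
  have hws : ∀ σ ∈ stabPerms u, ∀ i, w (σ i) = w i := fun σ hσ i => by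
    have := mem_stabPerms.1 hσ i
    simp only [hw]
    rw [this, hhc _ _ this]
  set Λ : (Fin n → ℝ) → ℝ := fun f => ∑ i, w i * Real.log (f i) with hΛ
  have hΛmul : ∀ f g : Fin n → ℝ, (∀ i, 0 < f i) → (∀ i, 0 < g i) → Λ (f * g) = Λ f + Λ g := by
    intro f g hf hg
    simp only [hΛ]
    rw [← Finset.sum_add_distrib]
    refine Finset.sum_congr rfl fun i _ => ?_
    rw [Pi.mul_apply, Real.log_mul (hf i).ne' (hg i).ne', mul_add]
  have hΛsmul : ∀ (c : ℝ) (f : Fin n → ℝ), 0 < c → (∀ i, 0 < f i) →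
      Λ (c • f) = Real.log c + Λ f := by
    intro c f hc hf
    have h1 : Λ (fun _ => c) = Real.log c := by
      simp only [hΛ]
      rw [← Finset.sum_mul, hw1, one_mul]
    rw [← h1, ← hΛmul _ _ (fun _ => hc) hf]
    rfl
  -- Near-optimality is not enough here: `u` is an exact maximizer after normalization. Apply `log t
  -- ≤ t - 1` to the normalized ratios `f / u`; the weights turn their mean into `h(f) / m(f) ≤ 1`.
  have hΛu : ∀ f, (∀ i, 0 < f i) → Λ f ≤ Λ u + Real.log (m f) - Real.log (m u) := by
    intro f hf
    have hmf := hm.pos f (hne f hf)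
    have h1 : Λ f - (Λ u + Real.log (m f) - Real.log (m u))
        ≤ ∑ i, w i * (f i * m u / (u i * m f) - 1) := by
      have : Λ f - (Λ u + Real.log (m f) - Real.log (m u))
          = ∑ i, w i * (Real.log (f i * m u / (u i * m f))) := by
        have h2 : ∑ i, w i * (Real.log (m f) - Real.log (m u))
            = Real.log (m f) - Real.log (m u) := by rw [← Finset.sum_mul, hw1, one_mul]
        rw [add_sub_assoc, ← h2]
        simp only [hΛ]
        rw [← Finset.sum_add_distrib, ← Finset.sum_sub_distrib]
        refine Finset.sum_congr rfl fun i _ => ?_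
        rw [Real.log_div (mul_pos (hf i) hL).ne' (mul_pos (hu0 i) hmf).ne',
          Real.log_mul (hf i).ne' hL.ne', Real.log_mul (hu0 i).ne' hmf.ne']
        ring
      rw [this]
      refine Finset.sum_le_sum fun i _ => mul_le_mul_of_nonneg_left ?_ (hw0 i)
      exact Real.log_le_sub_one_of_pos (div_pos (mul_pos (hf i) hL) (mul_pos (hu0 i) hmf))
    have h3 : ∑ i, w i * (f i * m u / (u i * m f) - 1) = (∑ i, h i * f i) / m f - 1 := by
      simp only [mul_sub, mul_one]
      rw [Finset.sum_sub_distrib, hw1, Finset.sum_div]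
      congr 1
      refine Finset.sum_congr rfl fun i _ => ?_
      have := (hu0 i).ne'
      simp only [hw]
      field_simp
    have h4 : (∑ i, h i * f i) / m f ≤ 1 := (div_le_one hmf).2 (hhf f fun i => (hf i).le)
    linarith
  set B : Set ℝ := Λ '' {g | (∀ i, 0 < g i) ∧ p g ≤ 1} with hB
  have hBn : B.Nonempty := by
    have h1 : 0 < p (fun _ => 1) := hp.pos _ (hne _ fun _ => one_pos)
    refine ⟨_, (p fun _ => 1)⁻¹ • (fun _ => 1), ⟨fun i => ?_, ?_⟩, rfl⟩
    · simpa using h1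
    · rw [hp.smul, abs_of_pos (inv_pos.2 h1), inv_mul_cancel₀ h1.ne']
  have hBb : BddAbove B := by
    refine ⟨∑ i, w i * (p (Pi.single i 1))⁻¹, ?_⟩
    rintro _ ⟨g, ⟨hg, hg1⟩, rfl⟩
    refine Finset.sum_le_sum fun i _ => mul_le_mul_of_nonneg_left ?_ (hw0 i)
    have he : 0 < p (Pi.single i 1) := hp.pos _ (by simp)
    have h1 : g i * p (Pi.single i 1) ≤ 1 := by
      have h2 := hp.smul (g i) (Pi.single i 1)
      rw [abs_of_pos (hg i)] at h2
      rw [← h2]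
      refine (hp.mono _ g fun j => ?_).trans hg1
      rcases eq_or_ne j i with rfl | hj
      · simp
      · simp [hj]
    have h2 : g i ≤ (p (Pi.single i 1))⁻¹ := by
      rw [← one_div]; exact (le_div_iff₀ he).2 h1
    linarith [Real.log_le_sub_one_of_pos (hg i)]
  -- A maximizer up to `1` suffices and avoids any compactness argument; this loss becomes the
  -- factor `exp 1`.
  obtain ⟨_, ⟨g₁, ⟨hg₁, hg₁p⟩, rfl⟩, hS⟩ :=
    exists_lt_of_lt_csSup hBn (sub_one_lt (sSup B))
  obtain ⟨σ, hσ⟩ := exists_antitone_comp_perm g₁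
  set g := levelAvg u (g₁ ∘ σ) with hg
  have hg0 : ∀ i, 0 < g i := levelAvg_pos u fun i => hg₁ _
  -- Sorting raises `Λ` because `w` is decreasing; averaging raises it by concavity of the
  -- logarithm, because `w` is constant on the level sets of `u`.
  have hΛg : Λ g₁ ≤ Λ g := by
    have hls : Antitone ((fun i => Real.log (g₁ i)) ∘ σ) := fun i j hij =>
      Real.log_le_log (hg₁ _) (hσ hij)
    refine (sum_mul_le_sum_mul_comp_perm hwa hls).trans ?_
    have := sum_mul_levelAvg u (fun i => Real.log (g₁ (σ i))) hws
    rw [← this]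
    exact Finset.sum_le_sum fun i _ => mul_le_mul_of_nonneg_left
      (levelAvg_log_le u (fun i => hg₁ _) i) (hw0 i)
  have hΛp : ∀ f, (∀ i, 0 < f i) → Λ f ≤ Real.log (p f) + Λ g + 1 := by
    intro f hf
    have hpf := hp.pos f (hne f hf)
    have h1 : Λ ((p f)⁻¹ • f) ∈ B := by
      refine ⟨_, ⟨fun i => ?_, ?_⟩, rfl⟩
      · exact mul_pos (inv_pos.2 hpf) (hf i)
      · rw [hp.smul, abs_of_pos (inv_pos.2 hpf), inv_mul_cancel₀ hpf.ne']
    have h2 := le_csSup hBb h1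
    rw [hΛsmul _ _ (inv_pos.2 hpf) hf, Real.log_inv] at h2
    linarith
  have hug : ∀ i, 0 < (u * g) i := fun i => mul_pos (hu0 i) (hg0 i)
  -- The factors are compared with `g` in `p` and with `u` in `m`. Since `Λ u + Λ g = Λ |g'| + Λ
  -- |f'|`, both `Λ u` and `Λ g` cancel, leaving a bound for `log (m u)`.
  obtain ⟨g', f', hz, hle⟩ := hfac (u * g) hug
  have hg'0 : ∀ i, 0 < |g' i| := fun i => abs_pos.2 fun h0 => by
    have := hug i; rw [hz, h0, zero_mul] at this; exact this.false
  have hf'0 : ∀ i, 0 < |f' i| := fun i => abs_pos.2 fun h0 => by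
    have := hug i; rw [hz, h0, mul_zero] at this; exact this.false
  have hpa := hp.mono (fun i => |g' i|) g' fun i => by simp
  have hma := hm.mono (fun i => |f' i|) f' fun i => by simp
  have hpp := hp.pos _ (hne _ hg'0)
  have hmp := hm.pos _ (hne _ hf'0)
  have hprod : (p fun i => |g' i|) * (m fun i => |f' i|) ≤ C * q (u * g) :=
    (mul_le_mul hpa hma hmp.le (hp.nonneg _)).trans hle
  have hzz : u * g = (fun i => |g' i|) * (fun i => |f' i|) := by
    funext i
    rw [Pi.mul_apply (fun i => |g' i|), ← abs_mul, ← hz, abs_of_pos (hug i)]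
  have e1 := hΛmul u g hu0 hg0
  rw [hzz, hΛmul _ _ hg'0 hf'0] at e1
  have e2 := hΛp _ hg'0
  have e3 := hΛu _ hf'0
  have hlog : Real.log (m u) ≤ 1 + Real.log (C * q (u * g)) := by
    have := Real.log_le_log (mul_pos hpp hmp) hprod
    rw [Real.log_mul hpp.ne' hmp.ne'] at this
    linarith
  have hCq : 0 < C * q (u * g) := (mul_pos hpp hmp).trans_le hprod
  refine ⟨g, levelAvg_antitone hu hσ, hg0, fun i j hij => levelAvg_congr u _ hij,
    (hp.levelAvg_le u _).trans ((hp.perm σ g₁).trans hg₁p), ?_⟩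
  have := Real.exp_le_exp.2 hlog
  rwa [Real.exp_log hL, Real.exp_add, Real.exp_log hCq, ← mul_assoc] at this

/-! ### Rearrangement invariance -/

/-- The norm does not increase under the reindexings by injective maps. -/
def IsSymm (Z : SeqSpace) : Prop :=
  ∀ τ : ℕ → ℕ, Function.Injective τ → ∀ x, Z.N (x ∘ τ) ≤ Z.N x

theorem Equimeasurable.symm {x y : ℕ → ℝ} (h : Equimeasurable x y) : Equimeasurable y x :=
  fun t ht => (h t ht).symm

theorem IsRI.N_eq {X : SeqSpace} (hX : X.IsRI) {x y : ℕ → ℝ} (h : Equimeasurable x y) :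
    X.N x = X.N y := by
  by_cases hy : X.Mem y
  · exact (hX.equimeasurable x y h hy).2
  · by_cases hx : X.Mem x
    · exact (hX.equimeasurable y x h.symm hx).2.symm
    · rw [Mem, lt_top_iff_ne_top, not_not] at hx hy
      rw [hx, hy]

theorem equimeasurable_extend {τ : ℕ → ℕ} (hτ : Function.Injective τ) (x : ℕ → ℝ) :
    Equimeasurable (Function.extend τ x 0) x := by
  intro t ht
  rw [← hτ.encard_image {n | t < |x n|}]
  congr 1
  ext n
  simp only [Set.mem_ofPred_eq, Set.mem_image]
  constructor
  · intro h
    by_cases hn : ∃ k, τ k = n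
    · obtain ⟨k, rfl⟩ := hn
      rw [hτ.extend_apply] at h
      exact ⟨k, h, rfl⟩
    · rw [Function.extend_apply' _ _ _ hn] at h
      simp at h
      exact absurd h (not_lt.2 ht)
  · rintro ⟨k, hk, rfl⟩
    rwa [hτ.extend_apply]

theorem IsRI.N_extend {X : SeqSpace} (hX : X.IsRI) {τ : ℕ → ℕ} (hτ : Function.Injective τ)
    (x : ℕ → ℝ) : X.N (Function.extend τ x 0) = X.N x :=
  hX.N_eq (equimeasurable_extend hτ x)

/-- Extending `x ∘ τ` back along `τ` gives `x` restricted to the range of `τ`. -/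
theorem IsRI.isSymm {X : SeqSpace} (hX : X.IsRI) : X.IsSymm := by
  intro τ hτ x
  rw [← hX.N_extend hτ]
  refine X.mono' _ _ fun n => ?_
  by_cases hn : ∃ k, τ k = n
  · obtain ⟨k, rfl⟩ := hn
    rw [hτ.extend_apply]; rfl
  · rw [Function.extend_apply' _ _ _ hn]
    simp

/-! ### Elementary properties of the norms -/

theorem N_le_of_abs_le (Z : SeqSpace) {x y : ℕ → ℝ} (h : ∀ n, |x n| ≤ y n) : Z.N x ≤ Z.N y :=
  Z.mono' _ _ fun n => (h n).trans (le_abs_self _)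

theorem N_congr_abs (Z : SeqSpace) {x y : ℕ → ℝ} (h : ∀ n, |x n| = |y n|) : Z.N x = Z.N y :=
  le_antisymm (Z.mono' _ _ fun n => (h n).le) (Z.mono' _ _ fun n => (h n).ge)

theorem N_ne_zero (Z : SeqSpace) {x : ℕ → ℝ} (hx : x ≠ 0) : Z.N x ≠ 0 :=
  fun h => hx (Z.eq_zero' x h)

theorem N_single_ne_zero (Z : SeqSpace) (n : ℕ) : Z.N (Pi.single n 1) ≠ 0 :=
  Z.N_ne_zero (by simp)

theorem enorm_mul_N_single_le (Z : SeqSpace) (x : ℕ → ℝ) (n : ℕ) :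
    ‖x n‖ₑ * Z.N (Pi.single n 1) ≤ Z.N x := by
  rw [← Z.smul']
  refine Z.mono' _ _ fun k => ?_
  rcases eq_or_ne k n with rfl | hk
  · simp
  · simp [hk]

theorem IsKothe.single_mem {X : SeqSpace} (hX : X.IsKothe) (n : ℕ) :
    X.Mem (Pi.single n 1) := by
  convert hX.indicator_mem {n} (Set.finite_singleton n)
  funext k
  by_cases h : k = n <;> simp [h]

theorem N_sum_le (Z : SeqSpace) {ι : Type*} (s : Finset ι) (f : ι → ℕ → ℝ) :
    Z.N (∑ i ∈ s, f i) ≤ ∑ i ∈ s, Z.N (f i) := by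
  classical
  induction s using Finset.induction_on with
  | empty => simp [N_zero]
  | insert a s ha ih =>
    rw [Finset.sum_insert ha, Finset.sum_insert ha]
    exact (Z.add_le' _ _).trans (add_le_add le_rfl ih)

theorem N_le_sum_of_support (Z : SeqSpace) {n : ℕ} {x : ℕ → ℝ} (hx : ∀ k, n ≤ k → x k = 0) :
    Z.N x ≤ ∑ k ∈ Finset.range n, ‖x k‖ₑ * Z.N (Pi.single k 1) := by
  have h : x = ∑ k ∈ Finset.range n, x k • (Pi.single k 1 : ℕ → ℝ) := by
    funext j
    simp only [Finset.sum_apply, Pi.smul_apply, Pi.single_apply, smul_eq_mul, mul_ite, mul_one,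
      mul_zero, Finset.sum_ite_eq, Finset.mem_range]
    split_ifs with hj
    · rfl
    · exact hx j (not_lt.1 hj)
  conv_lhs => rw [h]
  refine (Z.N_sum_le _ _).trans (Finset.sum_le_sum fun k _ => ?_)
  rw [Z.smul']

theorem mem_of_support (Z : SeqSpace) (hs : ∀ n, Z.Mem (Pi.single n 1)) {n : ℕ} {x : ℕ → ℝ}
    (hx : ∀ k, n ≤ k → x k = 0) : Z.Mem x :=
  (Z.N_le_sum_of_support hx).trans_lt
    (ENNReal.sum_lt_top.2 fun k _ => ENNReal.mul_lt_top enorm_lt_top (hs k))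

theorem enorm_inv_toReal {a : ℝ≥0∞} (h0 : a ≠ 0) (ht : a ≠ ∞) : ‖a.toReal⁻¹‖ₑ = a⁻¹ := by
  rw [Real.enorm_eq_ofReal (by positivity), ENNReal.ofReal_inv_of_pos
    (ENNReal.toReal_pos h0 ht), ENNReal.ofReal_toReal ht]

theorem N_normalize (Z : SeqSpace) {x : ℕ → ℝ} (h0 : Z.N x ≠ 0) (ht : Z.N x ≠ ∞) :
    Z.N ((Z.N x).toReal⁻¹ • x) = 1 := by
  rw [Z.smul', enorm_inv_toReal h0 ht, ENNReal.inv_mul_cancel h0 ht]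

/-! ### The Fatou property -/

theorem HasFatou.le_of_tendsto {Z : SeqSpace} (hZ : Z.HasFatou) {x : ℕ → ℕ → ℝ} {y : ℕ → ℝ}
    {B : ℝ≥0∞} (hx : ∀ k, Z.N (x k) ≤ B)
    (hy : ∀ n, Tendsto (fun k => x k n) atTop (𝓝 (y n))) : Z.N y ≤ B := by
  rcases eq_or_ne B ∞ with rfl | hB
  · exact le_top
  -- The slack `ε` makes the radius positive, so that rescaling to the unit ball also works for `B =
  -- 0`.
  refine ENNReal.le_of_forall_pos_le_add fun ε hε _ => ?_
  set b : ℝ≥0∞ := B + ε with hb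
  have hb0 : b ≠ 0 := by simp [hb, hε.ne']
  have hbt : b ≠ ∞ := by simp [hb, hB]
  have hmem : ∀ x, Z.N x ≤ b ↔ b.toReal⁻¹ • x ∈ {x : ℕ → ℝ | Z.N x ≤ 1} := fun x => by
    rw [Set.mem_ofPred_eq, Z.smul', enorm_inv_toReal hb0 hbt, mul_comm, ← div_eq_mul_inv,
      ENNReal.div_le_iff hb0 hbt, one_mul]
  rw [hmem]
  refine IsClosed.mem_of_tendsto hZ (tendsto_pi_nhds.2 fun n => ((hy n).const_smul b.toReal⁻¹))
    (Eventually.of_forall fun k => ?_)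
  exact (hmem (x k)).1 ((hx k).trans le_self_add)

/-! ### The space of multipliers -/

theorem N_mul_le_multNorm (X Y : SeqSpace) (f : ℕ → ℝ) {g : ℕ → ℝ} (hg : X.Mem g) :
    Y.N (f * g) ≤ multNorm X Y f * X.N g := by
  by_cases h0 : X.N g = 0
  · rw [X.eq_zero' g h0]; simp [N_zero]
  have h1 : Y.N (f * ((X.N g).toReal⁻¹ • g)) ≤ multNorm X Y f :=
    le_iSup₂_of_le (f := fun g (_ : X.N g = 1) => Y.N (f * g)) _ (X.N_normalize h0 hg.ne) le_rfl
  rw [mul_smul_comm, Y.smul', enorm_inv_toReal h0 hg.ne, mul_comm, ← div_eq_mul_inv,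
    ENNReal.div_le_iff h0 hg.ne] at h1
  exact h1

theorem multNorm_le {X Y : SeqSpace} {f : ℕ → ℝ} {B : ℝ≥0∞}
    (h : ∀ g, X.Mem g → Y.N (f * g) ≤ B * X.N g) : multNorm X Y f ≤ B :=
  iSup₂_le fun g hg => by
    have := h g (by rw [Mem, hg]; exact ENNReal.one_lt_top)
    rwa [hg, mul_one] at this

theorem multMem_of_multNorm_lt_top {X Y : SeqSpace} {f : ℕ → ℝ} (h : multNorm X Y f < ∞) :
    MultMem X Y f := fun _ hg =>
  (N_mul_le_multNorm X Y f hg).trans_lt (ENNReal.mul_lt_top h hg)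

theorem multNorm_single_lt_top {X Y : SeqSpace} (hY : Y.IsKothe) (n : ℕ) :
    multNorm X Y (Pi.single n 1) < ∞ := by
  refine lt_of_le_of_lt (b := (X.N (Pi.single n 1))⁻¹ * Y.N (Pi.single n 1)) ?_
    (ENNReal.mul_lt_top (ENNReal.inv_lt_top.2 (pos_iff_ne_zero.2 (X.N_single_ne_zero n)))
      (hY.single_mem n))
  refine iSup₂_le fun g hg => ?_
  have h1 : (Pi.single n 1 : ℕ → ℝ) * g = g n • Pi.single n 1 := by
    funext k
    rcases eq_or_ne k n with rfl | hk <;> simp [*]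
  rw [h1, Y.smul']
  gcongr
  rw [ENNReal.le_inv_iff_mul_le, ← hg]
  exact X.enorm_mul_N_single_le g n

/-- The space `M(X, Y)`. -/
noncomputable def mult (X Y : SeqSpace) (hX : X.IsKothe) : SeqSpace where
  N := multNorm X Y
  add_le' x y := iSup₂_le fun g hg => by
    rw [add_mul]
    exact (Y.add_le' _ _).trans (add_le_add
      (le_iSup₂_of_le (f := fun g (_ : X.N g = 1) => Y.N (x * g)) g hg le_rfl)
      (le_iSup₂_of_le (f := fun g (_ : X.N g = 1) => Y.N (y * g)) g hg le_rfl))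
  smul' c x := by
    simp only [multNorm, smul_mul_assoc, Y.smul', ENNReal.mul_iSup]
  eq_zero' x hx := by
    funext n
    have h := N_mul_le_multNorm X Y x (hX.single_mem n)
    rw [hx, zero_mul] at h
    have := congrFun (Y.eq_zero' _ (le_antisymm h zero_le)) n
    simpa using this
  mono' x y hxy := iSup₂_mono fun g _ => Y.mono' _ _ fun n => by
    simp only [Pi.mul_apply, abs_mul]
    exact mul_le_mul_of_nonneg_right (hxy n) (abs_nonneg _)

/-- Testing `f ∘ τ` on `g` amounts to testing `f` on the extension of `g` along `τ`, which has the
same `X`-norm. -/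
theorem mult_isSymm {X Y : SeqSpace} (hX : X.IsRI) (hY : Y.IsRI) :
    (mult X Y hX.toIsKothe).IsSymm := by
  intro τ hτ f
  refine multNorm_le fun g hg => ?_
  have h1 : f ∘ τ * g = (f * Function.extend τ g 0) ∘ τ := by
    funext n
    simp [hτ.extend_apply]
  rw [h1, ← hX.N_extend hτ g]
  refine (hY.isSymm τ hτ _).trans (N_mul_le_multNorm X Y f ?_)
  rw [Mem, hX.N_extend hτ]
  exact hg

/-! ### Restriction to finitely many coordinates -/

/-- Extension of a vector by zero. -/
noncomputable def extZero {n : ℕ} (x : Fin n → ℝ) : ℕ → ℝ := fun k =>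
  if h : k < n then x ⟨k, h⟩ else 0

theorem extZero_val {n : ℕ} (x : Fin n → ℝ) (i : Fin n) : extZero x i = x i := by
  simp [extZero]

theorem extZero_of_lt {n : ℕ} (x : Fin n → ℝ) {k : ℕ} (h : k < n) : extZero x k = x ⟨k, h⟩ := by
  simp [extZero, h]

theorem extZero_of_le {n : ℕ} (x : Fin n → ℝ) {k : ℕ} (h : n ≤ k) : extZero x k = 0 := by
  simp [extZero, not_lt.2 h]

theorem extZero_forall {n : ℕ} {P : ℝ → Prop} {x : Fin n → ℝ} (h0 : P 0) (h : ∀ i, P (x i))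
    (k : ℕ) : P (extZero x k) := by
  unfold extZero
  split_ifs with hk
  exacts [h _, h0]

theorem extZero_antitone {n : ℕ} {x : Fin n → ℝ} (hx : Antitone x) (h0 : ∀ i, 0 ≤ x i) :
    Antitone (extZero x) := by
  intro j k hjk
  by_cases hk : k < n
  · rw [extZero_of_lt x hk, extZero_of_lt x (hjk.trans_lt hk)]
    exact hx hjk
  · rw [extZero_of_le x (not_lt.1 hk)]
    exact extZero_forall le_rfl h0 j

theorem IsSymm.N_extZero_comp_perm {Z : SeqSpace} (hZ : Z.IsSymm) {n : ℕ}
    (σ : Equiv.Perm (Fin n)) (x : Fin n → ℝ) : Z.N (extZero (x ∘ σ)) ≤ Z.N (extZero x) := by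
  have : extZero (x ∘ σ) = extZero x ∘ σ.extendDomain Fin.equivSubtype := by
    funext k
    by_cases hk : k < n
    · rw [Function.comp_apply, Equiv.Perm.extendDomain_apply_subtype σ Fin.equivSubtype hk,
        extZero_of_lt _ hk]
      exact (extZero_val x _).symm
    · rw [Function.comp_apply, Equiv.Perm.extendDomain_apply_not_subtype σ Fin.equivSubtype hk,
        extZero_of_le _ (not_lt.1 hk), extZero_of_le _ (not_lt.1 hk)]
  rw [this]
  exact hZ _ (Equiv.injective _) _

theorem isSymmNorm_extZero {Z : SeqSpace} (hZ : Z.IsSymm) (hs : ∀ n, Z.Mem (Pi.single n 1))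
    (n : ℕ) : IsSymmNorm fun x : Fin n → ℝ => (Z.N (extZero x)).toReal where
  add_le x y := by
    have hx : Z.Mem (extZero x) := Z.mem_of_support hs fun k hk => extZero_of_le x hk
    have hy : Z.Mem (extZero y) := Z.mem_of_support hs fun k hk => extZero_of_le y hk
    rw [← ENNReal.toReal_add hx.ne hy.ne]
    refine ENNReal.toReal_mono (ENNReal.add_ne_top.2 ⟨hx.ne, hy.ne⟩) ?_
    have : extZero (x + y) = extZero x + extZero y := by
      funext k
      by_cases hk : k < n <;> simp [extZero, hk]
    rw [this]
    exact Z.add_le' _ _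
  smul c x := by
    have : extZero (c • x) = c • extZero x := by
      funext k
      by_cases hk : k < n <;> simp [extZero, hk]
    rw [this, Z.smul', ENNReal.toReal_mul, toReal_enorm, Real.norm_eq_abs]
  mono x y hxy := by
    have hy : Z.Mem (extZero y) := Z.mem_of_support hs fun k hk => extZero_of_le y hk
    refine ENNReal.toReal_mono hy.ne (Z.mono' _ _ fun k => ?_)
    by_cases hk : k < n
    · rw [extZero_of_lt _ hk, extZero_of_lt _ hk]; exact hxy _
    · rw [extZero_of_le _ (not_lt.1 hk), extZero_of_le _ (not_lt.1 hk)]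
  perm σ x := by
    have hx : Z.Mem (extZero x) := Z.mem_of_support hs fun k hk => extZero_of_le x hk
    exact ENNReal.toReal_mono hx.ne (hZ.N_extZero_comp_perm σ x)
  pos x hx := by
    have hm : Z.Mem (extZero x) := Z.mem_of_support hs fun k hk => extZero_of_le x hk
    refine ENNReal.toReal_pos (Z.N_ne_zero fun h => hx ?_) hm.ne
    funext i
    rw [← extZero_val x i, h]; rfl

/-! ### Factorization -/

/-- The infimum need not be attained, hence the factor `2`. Finiteness of the multiplier norm
follows from finiteness of the product with `X.N g ≠ 0`, so no closed graph argument is needed. -/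
theorem Factorizes.exists_factor {X Y : SeqSpace} (h : Factorizes X Y) :
    ∃ C : ℝ, 0 < C ∧ ∀ z, Y.Mem z → z ≠ 0 → ∃ g f, X.Mem g ∧ multNorm X Y f < ∞ ∧ z = g * f ∧
      X.N g * multNorm X Y f ≤ ENNReal.ofReal C * Y.N z := by
  obtain ⟨-, _, C, -, hC, hfac⟩ := h
  refine ⟨2 * C, by positivity, fun z hz hz0 => ?_⟩
  have h0 : ENNReal.ofReal C * Y.N z ≠ 0 :=
    mul_ne_zero (by simpa using hC) (Y.N_ne_zero hz0)
  have ht : ENNReal.ofReal C * Y.N z < ∞ := ENNReal.mul_lt_top ENNReal.ofReal_lt_top hz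
  have hlt : prodNorm X Y z < ENNReal.ofReal (2 * C) * Y.N z := by
    refine (hfac z hz).2.trans_lt ?_
    rw [ENNReal.ofReal_mul two_pos.le, mul_assoc, ENNReal.ofReal_ofNat, two_mul]
    exact ENNReal.lt_add_right ht.ne h0
  simp only [prodNorm, iInf_lt_iff] at hlt
  obtain ⟨g, f, ⟨hg, -, rfl⟩, hlt⟩ := hlt
  refine ⟨g, f, hg, ?_, rfl, hlt.le⟩
  have hg0 : X.N g ≠ 0 := X.N_ne_zero fun h => hz0 (by rw [h, zero_mul])
  by_contra htop
  rw [not_lt, top_le_iff] at htop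
  rw [htop, ENNReal.mul_top hg0] at hlt
  exact not_top_lt hlt

/-! ### Majorants -/

theorem abs_le_majorant_of_le {x : ℕ → ℝ} (hx : Bdd x) {n k : ℕ} (h : n ≤ k) :
    |x k| ≤ majorant x n := by
  obtain ⟨j, rfl⟩ := Nat.exists_eq_add_of_le h
  exact le_ciSup (hx.tail n) j

theorem majorant_le_iff {x : ℕ → ℝ} (hx : Bdd x) {n : ℕ} {a : ℝ} :
    majorant x n ≤ a ↔ ∀ k, n ≤ k → |x k| ≤ a :=
  ⟨fun h _ hk => (abs_le_majorant_of_le hx hk).trans h,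
    fun h => ciSup_le fun k => h _ (Nat.le_add_right n k)⟩

theorem majorant_antitone {x : ℕ → ℝ} (hx : Bdd x) : Antitone (majorant x) := fun _ _ hij =>
  (majorant_le_iff hx).2 fun _ hk => abs_le_majorant_of_le hx (hij.trans hk)

theorem bdd_of_antitone {x : ℕ → ℝ} (hx : Antitone x) (h0 : ∀ n, 0 ≤ x n) : Bdd x := by
  refine ⟨x 0, ?_⟩
  rintro _ ⟨n, rfl⟩
  simpa only [abs_of_nonneg (h0 n)] using hx (Nat.zero_le n)

theorem majorant_of_antitone {x : ℕ → ℝ} (hx : Antitone x) (h0 : ∀ n, 0 ≤ x n) :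
    majorant x = x := by
  funext n
  refine le_antisymm ((majorant_le_iff (bdd_of_antitone hx h0)).2 fun k hk => ?_) ?_
  · rw [abs_of_nonneg (h0 k)]; exact hx hk
  · exact (le_abs_self _).trans (abs_le_majorant_of_le (bdd_of_antitone hx h0) le_rfl)

theorem finite_range_of_support {x : ℕ → ℝ} {n : ℕ} (hx : ∀ k, n ≤ k → x k = 0) :
    (Set.range x).Finite := by
  refine ((Set.finite_Iio n).image x |>.insert 0).subset ?_
  rintro _ ⟨k, rfl⟩
  rcases lt_or_ge k n with hk | hk
  · exact Or.inr ⟨k, hk, rfl⟩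
  · exact Or.inl (hx k hk)

theorem bdd_of_support {x : ℕ → ℝ} {n : ℕ} (hx : ∀ k, n ≤ k → x k = 0) : Bdd x :=
  (finite_range_of_support (x := fun k => |x k|) (n := n) fun k hk => by simp [hx k hk]).bddAbove

theorem majorant_of_support {x : ℕ → ℝ} {n : ℕ} (hx : ∀ k, n ≤ k → x k = 0) {k : ℕ} (hk : n ≤ k) :
    majorant x k = 0 :=
  le_antisymm ((majorant_le_iff (bdd_of_support hx)).2 fun j hj => by
    simp [hx j (hk.trans hj)]) (majorant_nonneg x k)

theorem exists_abs_eq_majorant {x : ℕ → ℝ} {n : ℕ} (hx : ∀ k, n ≤ k → x k = 0) (i : ℕ) :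
    ∃ j, i ≤ j ∧ |x j| = majorant x i := by
  have hf : (Set.range fun k => |x (i + k)|).Finite :=
    finite_range_of_support (n := n) fun k hk => by simp [hx (i + k) (by omega)]
  obtain ⟨k, hk⟩ := (Set.range_nonempty fun k => |x (i + k)|).csSup_mem hf
  exact ⟨i + k, by omega, hk⟩

theorem indicator_Iio_of_le (x : ℕ → ℝ) (n : ℕ) : ∀ k, n ≤ k → (Set.Iio n).indicator x k = 0 :=
  fun _ hk => Set.indicator_of_notMem (by simpa using hk) _

theorem abs_indicator_le (s : Set ℕ) (x : ℕ → ℝ) (k : ℕ) : |s.indicator x k| ≤ |x k| := by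
  by_cases h : k ∈ s <;> simp [h]

theorem tendsto_majorant_truncation {x : ℕ → ℝ} (hx : Bdd x) (n : ℕ) :
    Tendsto (fun k => majorant ((Set.Iio k).indicator x) n) atTop (𝓝 (majorant x n)) := by
  refine tendsto_order.2 ⟨fun a ha => ?_, fun a ha => Eventually.of_forall fun k => ?_⟩
  · obtain ⟨j, hj⟩ := exists_lt_of_lt_ciSup ha
    filter_upwards [eventually_gt_atTop (n + j)] with k hk
    refine hj.trans_le ?_
    have := abs_le_majorant_of_le (bdd_of_support (indicator_Iio_of_le x k)) (Nat.le_add_right n j)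
    rwa [Set.indicator_of_mem (Set.mem_Iio.2 hk)] at this
  · exact (majorant_mono hx (abs_indicator_le _ x) n).trans_lt ha

/-! ### Multipliers between Tandori spaces -/

/-- The finite-dimensional result is applied to the majorant of `l` on its support; the test
sequence `g` it supplies turns the majorant of `l` times `g` into something controlled by the
majorant of `l * g`. -/
theorem exists_multNorm_majorant_le_of_support {X Y : SeqSpace} (hX : X.IsRI) (hY : Y.IsRI)
    (hfact : Factorizes X Y) :
    ∃ C : ℝ, 0 < C ∧ ∀ (l : ℕ → ℝ) (B : ℝ≥0∞), (∃ n, ∀ k, n ≤ k → l k = 0) →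
      (∀ (n : ℕ) (g : ℕ → ℝ), Antitone g → (∀ k, 0 ≤ g k) → (∀ k, n ≤ k → g k = 0) →
        Y.N (majorant (l * g)) ≤ B * X.N g) →
      multNorm X Y (majorant l) ≤ ENNReal.ofReal C * B := by
  obtain ⟨C, hC, hfac⟩ := hfact.exists_factor
  refine ⟨Real.exp 1 * C, by positivity, fun l B hl hB => ?_⟩
  set M := mult X Y hX.toIsKothe with hM
  rcases eq_or_ne B ∞ with rfl | hBt
  · rw [ENNReal.mul_top (by simp; positivity)]; exact le_top
  by_cases hl0 : ∀ k, 0 ≤ k → l k = 0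
  · have : majorant l = 0 := funext fun k => majorant_of_support hl0 (Nat.zero_le k)
    rw [this]
    exact M.N_zero.le.trans zero_le
  classical
  -- With the least such `n`, `l (n - 1) ≠ 0`, so the majorant is strictly positive on exactly the
  -- first `n` coordinates.
  set n := Nat.find hl with hn
  have hln : ∀ k, n ≤ k → l k = 0 := Nat.find_spec hl
  have hbd := bdd_of_support hln
  have hn0 : 0 < n := by
    rcases Nat.eq_zero_or_pos n with h | h
    · rw [h] at hln; exact absurd hln hl0
    · exact h
  have hlast : l (n - 1) ≠ 0 := fun h => by
    refine Nat.find_min hl (m := n - 1) (by omega) fun k hk => ?_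
    rcases eq_or_lt_of_le hk with rfl | hk'
    · exact h
    · exact hln k (by omega)
  set u : Fin n → ℝ := fun i => majorant l i with hu
  have hua : Antitone u := fun i j hij => majorant_antitone hbd hij
  have hu0 : ∀ i, 0 < u i := fun i =>
    (abs_pos.2 hlast).trans_le (abs_le_majorant_of_le hbd (by have := i.2; omega))
  have hue : extZero u = majorant l := by
    funext k
    by_cases hk : k < n
    · rw [extZero_of_lt u hk]
    · rw [extZero_of_le u (not_lt.1 hk), majorant_of_support hln (not_lt.1 hk)]
  have hMs : ∀ k, M.Mem (Pi.single k 1) := fun k => multNorm_single_lt_top hY.toIsKothe k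
  obtain ⟨g, hga, hg0, hgc, hg1, hle⟩ := exists_antitone_multiplier
    (p := fun x : Fin n → ℝ => (X.N (extZero x)).toReal)
    (m := fun x : Fin n → ℝ => (M.N (extZero x)).toReal)
    (q := fun x : Fin n → ℝ => (Y.N (extZero x)).toReal) (C := C) (u := u)
    (isSymmNorm_extZero hX.isSymm hX.toIsKothe.single_mem n)
    (isSymmNorm_extZero (mult_isSymm hX hY) hMs n) (fun z hz => by
      have hzm : Y.Mem (extZero z) :=
        Y.mem_of_support hY.toIsKothe.single_mem fun k hk => extZero_of_le z hk
      obtain ⟨g, f, hg, hf, hzf, hle⟩ := hfac (extZero z) hzm fun h0 => by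
        have h1 := congrFun h0 0
        rw [extZero_of_lt z hn0] at h1
        exact (hz _).ne' h1
      refine ⟨fun i => g i, fun i => f i, fun i => ?_, ?_⟩
      · rw [← extZero_val z i, hzf]; rfl
      · have hcut : ∀ (x : ℕ → ℝ) k, |extZero (fun i : Fin n => x i) k| ≤ |x k| := fun x k => by
          by_cases hk : k < n
          · rw [extZero_of_lt _ hk]
          · rw [extZero_of_le _ (not_lt.1 hk)]; simp
        rw [← ENNReal.toReal_mul, ← ENNReal.toReal_ofReal hC.le, ← ENNReal.toReal_mul]
        refine ENNReal.toReal_mono (ENNReal.mul_lt_top ENNReal.ofReal_lt_top hzm).ne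
          (le_trans ?_ hle)
        exact mul_le_mul' (X.mono' _ _ (hcut g)) (M.mono' _ _ (hcut f)))
    hua hu0 hn0
  have hGa := extZero_antitone hga fun i => (hg0 i).le
  have hG0 : ∀ k, 0 ≤ extZero g k := extZero_forall le_rfl fun i => (hg0 i).le
  have hGm : X.Mem (extZero g) :=
    X.mem_of_support hX.toIsKothe.single_mem fun k hk => extZero_of_le g hk
  have hGn : X.N (extZero g) ≤ 1 := by
    rw [← ENNReal.ofReal_toReal hGm.ne, ← ENNReal.ofReal_one]
    exact ENNReal.ofReal_le_ofReal hg1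
  have hYB : Y.N (extZero (u * g)) ≤ B := by
    -- The majorant at `k` is attained by `|l j|` for some `j ≥ k` in the same level set of `u`;
    -- there `g j = g k`, so `u k * g k = |l j * g j|`.
    have h1 : Y.N (extZero (u * g)) ≤ Y.N (majorant (l * extZero g)) := by
      have hb : Bdd (l * extZero g) := bdd_of_support (n := n) fun k hk => by simp [hln k hk]
      refine Y.N_le_of_abs_le fun k => ?_
      by_cases hk : k < n
      · obtain ⟨j, hkj, hj⟩ := exists_abs_eq_majorant hln k
        have hk0 : 0 < majorant l k := hu0 ⟨k, hk⟩
        have hjn : j < n := by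
          by_contra hjn
          rw [hln j (not_lt.1 hjn), abs_zero] at hj
          exact hk0.ne hj
        have hjk : u ⟨j, hjn⟩ = u ⟨k, hk⟩ :=
          le_antisymm (majorant_antitone hbd hkj) (hj.ge.trans (abs_le_majorant_of_le hbd le_rfl))
        have := abs_le_majorant_of_le hb hkj
        rw [Pi.mul_apply, abs_mul, hj, extZero_of_lt g hjn, hgc _ _ hjk,
          abs_of_pos (hg0 _)] at this
        rw [extZero_of_lt _ hk, Pi.mul_apply, abs_of_pos (mul_pos (hu0 _) (hg0 _))]
        exact this
      · rw [extZero_of_le _ (not_lt.1 hk), abs_zero]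
        exact majorant_nonneg _ _
    refine h1.trans ((hB n _ hGa hG0 fun k hk => extZero_of_le g hk).trans ?_)
    exact mul_le_of_le_one_right' hGn
  have hMm : M.Mem (majorant l) := M.mem_of_support hMs fun k hk => majorant_of_support hln hk
  simp only [hue] at hle
  show M.N (majorant l) ≤ _
  rw [← ENNReal.ofReal_toReal hMm.ne, ← ENNReal.ofReal_toReal hBt,
    ← ENNReal.ofReal_mul (by positivity)]
  refine ENNReal.ofReal_le_ofReal (hle.trans ?_)
  exact mul_le_mul_of_nonneg_left (ENNReal.toReal_mono hBt hYB) (by positivity)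

/-- Boundedness of the truncated multipliers on decreasing sequences implies that the majorant
is in `M(X, Y)`. -/
theorem exists_multNorm_majorant_le {X Y : SeqSpace} (hX : X.IsRI) (hY : Y.IsRI)
    (hYF : Y.HasFatou) (hfact : Factorizes X Y) :
    ∃ C : ℝ, 0 < C ∧ ∀ (l : ℕ → ℝ) (B : ℝ≥0∞), B ≠ ∞ →
      (∀ (k n : ℕ) (g : ℕ → ℝ), Antitone g → (∀ k, 0 ≤ g k) → (∀ k, n ≤ k → g k = 0) →
        Y.N (majorant ((Set.Iio k).indicator l * g)) ≤ B * X.N g) →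
      Bdd l ∧ multNorm X Y (majorant l) ≤ ENNReal.ofReal C * B := by
  obtain ⟨C, hC, h⟩ := exists_multNorm_majorant_le_of_support hX hY hfact
  refine ⟨C, hC, fun l B hB hl => ?_⟩
  have ht : ∀ k, multNorm X Y (majorant ((Set.Iio k).indicator l)) ≤ ENNReal.ofReal C * B :=
    fun k => h _ B ⟨k, indicator_Iio_of_le l k⟩ (hl k)
  set M := mult X Y hX.toIsKothe with hM
  have hCB : ENNReal.ofReal C * B ≠ ∞ := ENNReal.mul_ne_top ENNReal.ofReal_ne_top hB
  -- The first coordinates of the majorants of the truncations are uniformly bounded, and they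
  -- dominate every `|l k|`.
  have hbd : Bdd l := by
    set D := ENNReal.ofReal C * B / M.N (Pi.single 0 1) with hD
    have hDt : D ≠ ∞ := ENNReal.div_ne_top hCB (M.N_single_ne_zero 0)
    refine ⟨D.toReal, ?_⟩
    rintro _ ⟨k, rfl⟩
    have h1 := abs_le_majorant_of_le (bdd_of_support (indicator_Iio_of_le l (k + 1)))
      (Nat.zero_le k)
    rw [Set.indicator_of_mem (by simp)] at h1
    refine h1.trans ?_
    have h2 := (M.enorm_mul_N_single_le _ 0).trans (ht (k + 1))
    have h3 := ENNReal.toReal_mono hDt ((ENNReal.le_div_iff_mul_le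
      (Or.inl (M.N_single_ne_zero 0))
      (Or.inl (multNorm_single_lt_top hY.toIsKothe 0).ne)).2 h2)
    rw [toReal_enorm] at h3
    exact (le_abs_self _).trans h3
  refine ⟨hbd, multNorm_le fun g hg => ?_⟩
  refine hYF.le_of_tendsto (x := fun k => majorant ((Set.Iio k).indicator l) * g) (fun k => ?_)
    fun n => ?_
  · exact (N_mul_le_multNorm X Y _ hg).trans (mul_le_mul_left (ht k) _)
  · exact (tendsto_majorant_truncation hbd n).mul_const (g n)

/-! ### The normed space attached to a sequence space -/

theorem Elt.ext {Z : SeqSpace} {x y : Z.Elt} (h : x.seq = y.seq) : x = y := Subtype.ext h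

theorem Elt.mem {Z : SeqSpace} (x : Z.Elt) : Z.Mem x.seq := x.ne_top.lt_top

/-- The element of the normed space `Z.Elt` given by a sequence in `Z`. -/
def mkElt (Z : SeqSpace) (x : ℕ → ℝ) (hx : Z.Mem x) : Z.Elt := (⟨x, hx⟩ : Z.space)

theorem seq_mkElt {Z : SeqSpace} {x : ℕ → ℝ} (hx : Z.Mem x) : (Z.mkElt x hx).seq = x := rfl

theorem seq_add {Z : SeqSpace} (x y : Z.Elt) : (x + y).seq = x.seq + y.seq := rfl

theorem seq_sub {Z : SeqSpace} (x y : Z.Elt) : (x - y).seq = x.seq - y.seq := rfl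

theorem seq_smul {Z : SeqSpace} (c : ℝ) (x : Z.Elt) : (c • x).seq = c • x.seq := rfl

theorem norm_elt {Z : SeqSpace} (x : Z.Elt) : ‖x‖ = (Z.N x.seq).toReal := rfl

theorem ofReal_norm_elt {Z : SeqSpace} (x : Z.Elt) : ENNReal.ofReal ‖x‖ = Z.N x.seq := by
  rw [norm_elt, ENNReal.ofReal_toReal x.ne_top]

theorem norm_elt_le_iff {Z : SeqSpace} (x : Z.Elt) {b : ℝ} (hb : 0 ≤ b) :
    ‖x‖ ≤ b ↔ Z.N x.seq ≤ ENNReal.ofReal b := by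
  rw [← ofReal_norm_elt, ENNReal.ofReal_le_ofReal_iff hb]

theorem abs_seq_le {Z : SeqSpace} (x : Z.Elt) (n : ℕ) :
    |x.seq n| ≤ (Z.N (Pi.single n 1)).toReal⁻¹ * ‖x‖ := by
  have h := Z.enorm_mul_N_single_le x.seq n
  have h0 := Z.N_single_ne_zero n
  rcases eq_or_ne (x.seq n) 0 with hx | hx
  · rw [hx, abs_zero]; positivity
  rcases eq_or_ne (Z.N (Pi.single n 1)) ∞ with ht | ht
  · rw [ht, ENNReal.mul_top (by simpa using hx), top_le_iff] at h
    exact absurd h x.ne_top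
  · have := ENNReal.toReal_mono x.ne_top h
    rw [ENNReal.toReal_mul, toReal_enorm] at this
    rw [mul_comm, ← div_eq_mul_inv]
    exact (le_div_iff₀ (ENNReal.toReal_pos h0 ht)).2 this

/-- The coordinate functionals. -/
noncomputable def coord (Z : SeqSpace) (n : ℕ) : Z.Elt →L[ℝ] ℝ :=
  LinearMap.mkContinuous
    { toFun := fun x => x.seq n, map_add' := fun _ _ => rfl, map_smul' := fun _ _ => rfl }
    _ fun x => abs_seq_le x n

theorem coord_apply {Z : SeqSpace} (x : Z.Elt) (n : ℕ) : Z.coord n x = x.seq n := rfl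

/-- Cauchy sequences converge coordinatewise; the Fatou bound applied to differences upgrades this
to norm convergence. -/
theorem completeSpace_of_fatou {Z : SeqSpace}
    (hZ : ∀ (x : ℕ → ℕ → ℝ) (y : ℕ → ℝ) (B : ℝ≥0∞), B ≠ ∞ → (∀ k, Z.N (x k) ≤ B) →
      (∀ n, Tendsto (fun k => x k n) atTop (𝓝 (y n))) → Z.N y ≤ B) :
    CompleteSpace Z.Elt := by
  refine Metric.complete_of_cauchySeq_tendsto fun x hx => ?_
  have hc : ∀ n, ∃ a, Tendsto (fun k => (x k).seq n) atTop (𝓝 a) := fun n =>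
    cauchySeq_tendsto_of_complete ((Z.coord n).uniformContinuous.comp_cauchySeq hx)
  choose y hy using hc
  have key : ∀ ε > 0, ∃ m, ∀ j, m ≤ j → Z.N ((x j).seq - y) ≤ ENNReal.ofReal ε := by
    intro ε hε
    obtain ⟨m, hm⟩ := Metric.cauchySeq_iff.1 hx ε hε
    refine ⟨m, fun j hj => ?_⟩
    refine hZ (fun k => (x j).seq - (x (m + k)).seq) _ _ ENNReal.ofReal_ne_top (fun k => ?_)
      fun n => ?_
    · rw [← seq_sub, ← norm_elt_le_iff _ hε.le, ← dist_eq_norm]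
      exact (hm j hj (m + k) (Nat.le_add_right m k)).le
    · exact tendsto_const_nhds.sub
        ((hy n).comp (tendsto_atTop_mono (fun k => Nat.le_add_left k m) tendsto_id))
  have hym : Z.Mem y := by
    obtain ⟨m, hm⟩ := key 1 one_pos
    have h1 : y = (x m).seq + (-1 : ℝ) • ((x m).seq - y) := by
      funext n; simp
    rw [Mem, h1]
    refine (Z.add_le' _ _).trans_lt (ENNReal.add_lt_top.2 ⟨(x m).mem, ?_⟩)
    rw [Z.smul']
    exact ENNReal.mul_lt_top enorm_lt_top ((hm m le_rfl).trans_lt ENNReal.ofReal_lt_top)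
  refine ⟨Z.mkElt y hym, Metric.tendsto_atTop.2 fun ε hε => ?_⟩
  obtain ⟨m, hm⟩ := key (ε / 2) (half_pos hε)
  refine ⟨m, fun j hj => ?_⟩
  rw [dist_eq_norm]
  refine lt_of_le_of_lt ?_ (half_lt_self hε)
  rw [norm_elt_le_iff _ (half_pos hε).le]
  exact hm j hj

/-! ### Tails and order continuity -/

theorem tail_of_le (x : ℕ → ℝ) {n k : ℕ} (h : n ≤ k) : tail x n k = x k :=
  Set.indicator_of_mem (Set.mem_Ici.2 h) _

theorem tail_of_lt (x : ℕ → ℝ) {n k : ℕ} (h : k < n) : tail x n k = 0 :=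
  Set.indicator_of_notMem (by simpa using h) _

theorem tail_add (x y : ℕ → ℝ) (n : ℕ) : tail (x + y) n = tail x n + tail y n :=
  Set.indicator_add _ _ _

theorem abs_tail_le (x : ℕ → ℝ) (n k : ℕ) : |tail x n k| ≤ |x k| := abs_indicator_le _ _ _

theorem truncation_add_tail (x : ℕ → ℝ) (n : ℕ) : (Set.Iio n).indicator x + tail x n = x := by
  rw [tail, ← Set.compl_Iio, Set.indicator_self_add_compl]

theorem tendsto_N_of_support {Z : SeqSpace} (hs : ∀ n, Z.Mem (Pi.single n 1)) {n : ℕ}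
    {x : ℕ → ℕ → ℝ} (hx : ∀ j k, n ≤ k → x j k = 0)
    (h0 : ∀ k, Tendsto (fun j => x j k) atTop (𝓝 0)) :
    Tendsto (fun j => Z.N (x j)) atTop (𝓝 0) := by
  refine tendsto_of_tendsto_of_tendsto_of_le_of_le tendsto_const_nhds ?_ (fun _ => zero_le)
    fun j => Z.N_le_sum_of_support (hx j)
  have : (0 : ℝ≥0∞) = ∑ k ∈ Finset.range n, 0 * Z.N (Pi.single k 1) := by simp
  rw [this]
  refine tendsto_finsetSum _ fun k _ => ENNReal.Tendsto.mul_const ?_ (Or.inr (hs k).ne)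
  simpa using (h0 k).enorm

/-- The first `n` coordinates span a finite-dimensional space, where coordinatewise and norm
convergence agree, so only tails matter. -/
theorem isOCElement_iff_tendsto_tail {Z : SeqSpace} (hs : ∀ n, Z.Mem (Pi.single n 1))
    (f : ℕ → ℝ) :
    IsOCElement Z.N f ↔ Tendsto (fun n => Z.N (tail f n)) atTop (𝓝 0) := by
  constructor
  · intro h
    have := h (fun n => tail (fun k => |f k|) n) (fun n k => ?_) (fun n k => ?_) (fun k => ?_)
      fun k => ?_
    · refine this.congr fun n => Z.N_congr_abs fun k => ?_
      rcases le_or_gt n k with hk | hk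
      · rw [tail_of_le _ hk, tail_of_le _ hk, abs_abs]
      · rw [tail_of_lt _ hk, tail_of_lt _ hk]
    · exact Set.indicator_nonneg (fun _ _ => abs_nonneg _) k
    · exact Set.indicator_le_self' (fun _ _ => abs_nonneg _) k
    · intro m n hmn
      refine Set.indicator_le_indicator_of_subset (Set.Ici_subset_Ici.2 hmn)
        (fun _ => abs_nonneg _) k
    · refine tendsto_const_nhds.congr' ?_
      filter_upwards [eventually_gt_atTop k] with n hn
      exact (tail_of_lt _ hn).symm
  · intro h u hu0 huf _ hut
    refine ENNReal.tendsto_nhds_zero.2 fun ε hε => ?_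
    obtain ⟨n, hn⟩ := (ENNReal.tendsto_nhds_zero.1 h (ε / 2) (ENNReal.half_pos hε.ne')).exists
    have h1 := tendsto_N_of_support hs (x := fun j => (Set.Iio n).indicator (u j))
      (fun j => indicator_Iio_of_le (u j) n) fun k => by
        by_cases hk : k ∈ Set.Iio n
        · simpa only [Set.indicator_of_mem hk] using hut k
        · simp only [Set.indicator_of_notMem hk]; exact tendsto_const_nhds
    filter_upwards [ENNReal.tendsto_nhds_zero.1 h1 (ε / 2) (ENNReal.half_pos hε.ne')] with j hj
    rw [← truncation_add_tail (u j) n, ← ENNReal.add_halves ε]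
    refine (Z.add_le' _ _).trans (add_le_add hj (le_trans (Z.mono' _ _ fun k => ?_) hn))
    rcases le_or_gt n k with hk | hk
    · rw [tail_of_le _ hk, tail_of_le _ hk, abs_of_nonneg (hu0 j k)]; exact huf j k
    · rw [tail_of_lt _ hk, tail_of_lt _ hk]

/-- By symmetry the norms of the unit vectors are bounded below by that of the first one, so small
tails force small entries. -/
theorem IsOC.tendsto_zero {Z : SeqSpace} (hZ : Z.IsOC) (hR : Z.IsRI) {x : ℕ → ℝ}
    (hm : Z.Mem x) : Tendsto x atTop (𝓝 0) := by
  have hs := hR.toIsKothe.single_mem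
  have h1 := (isOCElement_iff_tendsto_tail hs x).1 (hZ x hm)
  have h2 : ∀ n, ‖x n‖ₑ ≤ Z.N (tail x n) / Z.N (Pi.single 0 1) := fun n => by
    rw [ENNReal.le_div_iff_mul_le (Or.inl (Z.N_single_ne_zero 0)) (Or.inl (hs 0).ne)]
    have h3 := Z.enorm_mul_N_single_le (tail x n) n
    rw [tail_of_le _ le_rfl] at h3
    refine le_trans (mul_le_mul_right ?_ _) h3
    have h4 := hR.isSymm (fun k => k + n) (add_left_injective n) (Pi.single n 1)
    refine le_trans (le_of_eq (congrArg Z.N ?_)) h4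
    funext k
    simp [Pi.single_apply]
  have h3 : Tendsto (fun n => ‖x n‖ₑ) atTop (𝓝 0) := by
    refine tendsto_of_tendsto_of_tendsto_of_le_of_le tendsto_const_nhds ?_ (fun _ => zero_le) h2
    have := ENNReal.Tendsto.div_const h1 (b := Z.N (Pi.single 0 1)) (Or.inr (Z.N_single_ne_zero 0))
    rwa [ENNReal.zero_div] at this
  have h4 := (ENNReal.tendsto_toReal ENNReal.zero_ne_top).comp h3
  simp only [Function.comp_def, toReal_enorm, ENNReal.toReal_zero] at h4
  exact tendsto_zero_iff_norm_tendsto_zero.2 h4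

theorem Factorizes.isOC {X Y : SeqSpace} (h : Factorizes X Y) (hX : X.IsOC) : Y.IsOC := by
  obtain ⟨C, -, hfac⟩ := h.exists_factor
  intro y hy u hu0 huy hua hut
  rcases eq_or_ne y 0 with rfl | hy0
  · have : u = fun _ => 0 := by
      funext k n
      exact le_antisymm (by simpa using huy k n) (hu0 k n)
    rw [this]
    simp [N_zero]
  obtain ⟨g, f, hg, hf, rfl, -⟩ := hfac y hy hy0
  -- Dividing by the fixed multiplier `f` transfers the decreasing sequence to `X`. Where `f n = 0`,
  -- both `u k n` and the quotient vanish.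
  have h1 := hX g hg (fun k n => u k n / |f n|) (fun k n => div_nonneg (hu0 k n) (abs_nonneg _))
    (fun k n => ?_) (fun n j k hjk => div_le_div_of_nonneg_right (hua n hjk) (abs_nonneg _))
    fun n => by simpa using (hut n).div_const |f n|
  · refine tendsto_of_tendsto_of_tendsto_of_le_of_le' tendsto_const_nhds
      (by simpa using ENNReal.Tendsto.const_mul h1 (Or.inr hf.ne))
      (Eventually.of_forall fun _ => zero_le) ?_
    filter_upwards [ENNReal.tendsto_nhds_zero.1 h1 1 one_pos] with k hk
    refine le_trans (Y.mono' _ (f * fun n => u k n / |f n|) fun n => ?_)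
      (N_mul_le_multNorm X Y f (hk.trans_lt ENNReal.one_lt_top))
    rw [Pi.mul_apply, abs_mul, abs_div, abs_abs]
    rcases eq_or_ne (f n) 0 with h0 | h0
    · have := huy k n
      rw [Pi.mul_apply, h0, mul_zero, abs_zero] at this
      rw [le_antisymm this (hu0 k n)]; simp
    · rw [mul_div_cancel₀ _ (abs_pos.2 h0).ne']
  · rcases eq_or_ne (f n) 0 with h0 | h0
    · simp [h0]
    · rw [div_le_iff₀ (abs_pos.2 h0), ← abs_mul]; exact huy k n

/-- Reflexivity makes `0` a weak cluster point of the order bounded sequence `u`. By Hahn–Banach,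
`0` is then a norm limit of elements dominating some `u m`, and such an element dominates all later
`u k`. -/
theorem IsReflexive.isOC {Y : SeqSpace} (hR : Y.IsReflexive) : Y.IsOC := by
  intro f hf u hu0 huf hua hut
  have hum : ∀ k, Y.Mem (u k) := fun k => (Y.mono' _ f fun n => by
    rw [abs_of_nonneg (hu0 k n)]; exact huf k n).trans_lt hf
  set v : ℕ → Y.Elt := fun k => Y.mkElt (u k) (hum k) with hv
  set S : Set Y.Elt := {z | ∃ m, ∀ n, u m n ≤ z.seq n} with hS
  have hSc : Convex ℝ S := by
    rintro x ⟨m, hm⟩ y ⟨k, hk⟩ a b ha hb hab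
    refine ⟨max m k, fun n => ?_⟩
    have h1 := (hua n (le_max_left m k)).trans (hm n)
    have h2 := (hua n (le_max_right m k)).trans (hk n)
    have h3 : u (max m k) n = a * u (max m k) n + b * u (max m k) n := by
      rw [← add_mul, hab, one_mul]
    rw [h3]
    exact add_le_add (mul_le_mul_of_nonneg_left h1 ha) (mul_le_mul_of_nonneg_left h2 hb)
  have h0 : (0 : Y.Elt) ∈ closure S := by
    by_contra hcl
    obtain ⟨φ, δ, hδ, hφ⟩ := geometric_hahn_banach_point_closed hSc.closure isClosed_closure hcl
    rw [map_zero] at hδ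
    have hφv : ∀ k, δ < φ (v k) := fun k => hφ _ (subset_closure ⟨k, fun n => le_rfl⟩)
    set R := (Y.N f).toReal with hRdef
    have hvR : ∀ k, ‖v k‖ ≤ R := fun k => by
      refine ENNReal.toReal_mono hf.ne (Y.mono' _ f fun n => ?_)
      show |u k n| ≤ |f n|
      rw [abs_of_nonneg (hu0 k n)]; exact huf k n
    -- Banach–Alaoglu in the bidual gives a weak-star cluster point. Reflexivity represents it by
    -- some `x`, all of whose coordinates vanish, which contradicts the strict separation by `φ`.
    have hcomp := WeakDual.isCompact_closedBall (𝕜 := ℝ) (E := StrongDual ℝ Y.Elt) 0 R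
    set J : ℕ → WeakDual ℝ (StrongDual ℝ Y.Elt) := fun k =>
      StrongDual.toWeakDual (NormedSpace.inclusionInDoubleDual ℝ Y.Elt (v k)) with hJ
    obtain ⟨Φ, -, hΦ⟩ := hcomp.exists_mapClusterPt (f := atTop) (u := J) (by
      refine tendsto_principal.2 (Eventually.of_forall fun k => ?_)
      show NormedSpace.inclusionInDoubleDual ℝ Y.Elt (v k) ∈ Metric.closedBall 0 R
      refine (mem_closedBall_zero_iff (E := StrongDual ℝ (StrongDual ℝ Y.Elt))).2 ?_
      exact (NormedSpace.double_dual_bound ℝ Y.Elt (v k)).trans (hvR k))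
    have hcl : ∀ ψ : StrongDual ℝ Y.Elt, MapClusterPt (Φ ψ) atTop fun k => ψ (v k) := fun ψ =>
      hΦ.continuousAt_comp (f := fun Ψ : WeakDual ℝ (StrongDual ℝ Y.Elt) => Ψ ψ)
        (WeakDual.eval_continuous ψ).continuousAt
    obtain ⟨x, hx⟩ := hR (WeakDual.toStrongDual Φ)
    have hxψ : ∀ ψ : StrongDual ℝ Y.Elt, Φ ψ = ψ x := fun ψ =>
      (DFunLike.congr_fun hx ψ).symm
    have hx0 : x = 0 := by
      refine Elt.ext (funext fun n => ?_)
      have h1 := hcl (Y.coord n)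
      rw [hxψ] at h1
      have h2 : Tendsto (fun k => Y.coord n (v k)) atTop (𝓝 0) := hut n
      exact eq_of_nhds_neBot (h1.clusterPt.neBot.mono (inf_le_inf_left _ h2))
    have h1 := hcl φ
    rw [hxψ, hx0, map_zero] at h1
    obtain ⟨k, hk⟩ := (h1.frequently (Iio_mem_nhds hδ)).exists
    exact lt_asymm (hφv k) hk
  refine ENNReal.tendsto_nhds_zero.2 fun ε hε => ?_
  obtain ⟨ε', hε'0, hε'⟩ := ENNReal.lt_iff_exists_real_btwn.1 hε
  have hpos : 0 < ε' := by simpa using hε'.1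
  obtain ⟨z, ⟨m, hm⟩, hz⟩ := Metric.mem_closure_iff.1 h0 ε' hpos
  rw [dist_zero_left] at hz
  filter_upwards [eventually_ge_atTop m] with k hk
  refine le_trans (Y.mono' _ z.seq fun n => ?_) (((norm_elt_le_iff z hpos.le).1 hz.le).trans
    hε'.2.le)
  rw [abs_of_nonneg (hu0 k n)]
  exact (hua n hk).trans ((hm n).trans (le_abs_self _))

/-! ### Multiplication operators -/

theorem IsMulOp.N_le {E F : SeqSpace} {l : ℕ → ℝ} {T : E.Elt →L[ℝ] F.Elt} (hT : IsMulOp l T)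
    {x : ℕ → ℝ} (hx : E.Mem x) : F.N (l * x) ≤ ENNReal.ofReal ‖T‖ * E.N x := by
  have h := T.le_opNorm (E.mkElt x hx)
  rw [norm_elt_le_iff _ (by positivity), hT, seq_mkElt, ENNReal.ofReal_mul (norm_nonneg _),
    ofReal_norm_elt, seq_mkElt] at h
  exact h

theorem IsMulOp.opNorm_le {E F : SeqSpace} {l : ℕ → ℝ} {T : E.Elt →L[ℝ] F.Elt} (hT : IsMulOp l T)
    {b : ℝ} (hb : 0 ≤ b) (h : ∀ x, E.Mem x → F.N (l * x) ≤ ENNReal.ofReal b * E.N x) :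
    ‖T‖ ≤ b := by
  refine T.opNorm_le_bound hb fun x => ?_
  rw [norm_elt_le_iff _ (by positivity), hT, ENNReal.ofReal_mul hb, ofReal_norm_elt]
  exact h _ x.mem

theorem exists_isMulOp {E F : SeqSpace} {l : ℕ → ℝ} {b : ℝ} (hb : 0 ≤ b)
    (h : ∀ x, E.Mem x → F.N (l * x) ≤ ENNReal.ofReal b * E.N x) :
    ∃ T : E.Elt →L[ℝ] F.Elt, IsMulOp l T := by
  have hm : ∀ x : E.Elt, F.Mem (l * x.seq) := fun x =>
    (h _ x.mem).trans_lt (ENNReal.mul_lt_top ENNReal.ofReal_lt_top x.mem)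
  refine ⟨LinearMap.mkContinuous
    { toFun := fun x => F.mkElt (l * x.seq) (hm x)
      map_add' := fun x y => Elt.ext (mul_add l x.seq y.seq)
      map_smul' := fun c x => Elt.ext (mul_smul_comm c l x.seq) } b fun x => ?_, fun x => rfl⟩
  rw [norm_elt_le_iff _ (by positivity), ENNReal.ofReal_mul hb, ofReal_norm_elt]
  exact h _ x.mem

theorem IsMulOp.sub {E F : SeqSpace} {l m : ℕ → ℝ} {T S : E.Elt →L[ℝ] F.Elt} (hT : IsMulOp l T)
    (hS : IsMulOp m S) : IsMulOp (l - m) (T - S) := fun x => by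
  rw [_root_.sub_apply, seq_sub, hT, hS, sub_mul]

theorem exists_compact_truncation (E : SeqSpace) {F : SeqSpace}
    (hs : ∀ n, F.Mem (Pi.single n 1)) (l : ℕ → ℝ) (n : ℕ) :
    ∃ K : E.Elt →L[ℝ] F.Elt, IsCompactOperator K ∧ IsMulOp ((Set.Iio n).indicator l) K := by
  induction n with
  | zero =>
    refine ⟨0, isCompactOperator_zero, fun x => ?_⟩
    have : (Set.Iio 0).indicator l = 0 := by funext k; simp
    rw [this, zero_mul]; rfl
  | succ n ih =>
    obtain ⟨K, hK, hKl⟩ := ih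
    refine ⟨K + (ContinuousLinearMap.toSpanSingleton ℝ (l n • F.mkElt _ (hs n))).comp (E.coord n),
      ?_, fun x => ?_⟩
    · exact hK.add ((isCompactOperator_of_locallyCompactSpace_dom (E.coord n)).clm_comp
        (ContinuousLinearMap.toSpanSingleton ℝ (l n • F.mkElt _ (hs n))))
    · rw [_root_.add_apply, seq_add, hKl, ContinuousLinearMap.comp_apply,
        ContinuousLinearMap.toSpanSingleton_apply, seq_smul, seq_smul, coord_apply, seq_mkElt]
      funext k
      rcases lt_trichotomy k n with h | rfl | h
      · simp [h.ne, h, h.trans (Nat.lt_succ_self n)]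
      · simp [mul_comm]
      · simp [h.ne', not_lt.2 h.le, not_lt.2 (Nat.succ_le_of_lt h)]

/-! ### Essential norms and tails of the symbol -/

theorem sub_truncation (l : ℕ → ℝ) (n : ℕ) : l - (Set.Iio n).indicator l = tail l n :=
  sub_eq_of_eq_add' (truncation_add_tail l n).symm

theorem bdd_tail {l : ℕ → ℝ} (hl : Bdd l) (n : ℕ) : Bdd (tail l n) := hl.mono (abs_tail_le l n)

theorem abs_tail_majorant_le {l : ℕ → ℝ} (hl : Bdd l) (n k : ℕ) :
    |tail (majorant l) n k| ≤ majorant (tail l n) k := by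
  rcases le_or_gt n k with hk | hk
  · rw [tail_of_le _ hk, abs_of_nonneg (majorant_nonneg _ _)]
    refine (majorant_le_iff hl).2 fun j hj => ?_
    rw [← tail_of_le l (hk.trans hj)]
    exact abs_le_majorant_of_le (bdd_tail hl n) hj
  · rw [tail_of_lt _ hk, abs_zero]
    exact majorant_nonneg _ _

/-- The majorant of a tail is constant on an initial segment, so it exceeds the tail of the
majorant. Cutting at `2 * n` makes room: on the first `n` coordinates it lies below a translate by
`n` of the tail cut at `n`. -/
theorem IsSymm.N_majorant_tail_le {Z : SeqSpace} (hZ : Z.IsSymm) {l : ℕ → ℝ} (hl : Bdd l) (n : ℕ) :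
    Z.N (majorant (tail l (2 * n))) ≤ 2 * Z.N (tail (majorant l) n) := by
  set t := tail (majorant l) n with ht
  have ht0 : ∀ k, 0 ≤ t k := fun k => Set.indicator_nonneg (fun _ _ => majorant_nonneg _ _) k
  have h1 : Z.N (majorant (tail l (2 * n))) ≤ Z.N (t + t ∘ (· + n)) := by
    refine Z.N_le_of_abs_le fun k => ?_
    rw [abs_of_nonneg (majorant_nonneg _ _), Pi.add_apply, Function.comp_apply]
    rcases le_or_gt n k with hk | hk
    · refine le_add_of_le_of_nonneg ?_ (ht0 _)
      rw [ht, tail_of_le _ hk]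
      exact majorant_mono hl (abs_tail_le l _) k
    · refine le_add_of_nonneg_of_le (ht0 _) ?_
      rw [ht, tail_of_le _ (Nat.le_add_left n k)]
      refine (majorant_le_iff (bdd_tail hl _)).2 fun j hj => ?_
      rcases le_or_gt (2 * n) j with h | h
      · exact (abs_tail_le l _ j).trans (abs_le_majorant_of_le hl (by omega))
      · rw [tail_of_lt _ h, abs_zero]; exact majorant_nonneg _ _
  refine h1.trans ((Z.add_le' _ _).trans ?_)
  rw [two_mul]
  exact add_le_add le_rfl (hZ _ (add_left_injective n) t)

/-- Up to a small error, the distance to a compact operator controls the norms of the tails. -/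
theorem exists_tail_N_le {E F : SeqSpace}
    (htail : ∀ z, F.Mem z → Tendsto (fun n => F.N (tail z n)) atTop (𝓝 0))
    {l : ℕ → ℝ} {T K : E.Elt →L[ℝ] F.Elt} (hT : IsMulOp l T) (hK : IsCompactOperator K)
    {η : ℝ} (hη : 0 < η) :
    ∃ n, ∀ x, E.Mem x → F.N (tail l n * x) ≤ ENNReal.ofReal (‖T - K‖ + η) * E.N x := by
  by_contra! hcon
  choose x hx hlt using hcon
  set D := ‖T - K‖ with hD
  have hx0 : ∀ n, E.N (x n) ≠ 0 := fun n h0 => by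
    have := hlt n
    rw [E.eq_zero' _ h0, mul_zero, F.N_zero] at this
    exact not_lt_zero this
  set c : ℕ → ℝ := fun n => (E.N (x n)).toReal⁻¹ with hc
  have hyN : ∀ n, E.N (tail (c n • x n) n) ≤ 1 := fun n =>
    (E.mono' _ _ (abs_tail_le _ n)).trans (E.N_normalize (hx0 n) (hx n).ne).le
  have hym : ∀ n, E.Mem (tail (c n • x n) n) := fun n => (hyN n).trans_lt ENNReal.one_lt_top
  -- Test vectors in the unit ball supported on `[n, ∞)`. They need not be weakly null: only tails
  -- of the images under `K` enter below.
  set y : ℕ → E.Elt := fun n => E.mkElt _ (hym n) with hy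
  have hyl : ∀ n, ENNReal.ofReal (D + η) ≤ F.N (l * (y n).seq) := fun n => by
    have h1 : l * (y n).seq = c n • (tail l n * x n) := by
      funext k
      show l k * tail (c n • x n) n k = c n * (tail l n k * x n k)
      rcases le_or_gt n k with hk | hk
      · rw [tail_of_le _ hk, tail_of_le _ hk, Pi.smul_apply, smul_eq_mul]; ring
      · rw [tail_of_lt _ hk, tail_of_lt _ hk]; simp
    rw [h1, F.smul', hc, enorm_inv_toReal (hx0 n) (hx n).ne, mul_comm, ← div_eq_mul_inv,
      ENNReal.le_div_iff_mul_le (Or.inl (hx0 n)) (Or.inl (hx n).ne)]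
    exact (hlt n).le
  have hy1 : ∀ n, ‖y n‖ ≤ 1 := fun n => by
    rw [norm_elt_le_iff _ zero_le_one, ENNReal.ofReal_one]; exact hyN n
  obtain ⟨Q, hQ, hKQ⟩ :=
    IsCompactOperator.image_closedBall_subset_compact (f := (K : E.Elt →ₗ[ℝ] F.Elt)) hK 1
  obtain ⟨a, -, φ, hφ, hlim⟩ := hQ.tendsto_subseq (x := fun n => K (y n)) fun n =>
    hKQ ⟨y n, mem_closedBall_zero_iff.2 (hy1 n), rfl⟩
  -- On the tail, `T y = (T - K) y + (K y - a) + a`; the last two terms vanish in the limit,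
  -- contradicting the gap `η`.
  have hbound : ∀ j, ENNReal.ofReal (D + η) ≤ ENNReal.ofReal D
      + (ENNReal.ofReal ‖K (y (φ j)) - a‖ + F.N (tail a.seq (φ j))) := by
    intro j
    set k := φ j
    have h1 : l * (y k).seq
        = tail ((T - K) (y k)).seq k + (tail (K (y k) - a).seq k + tail a.seq k) := by
      rw [← tail_add, ← tail_add, ← seq_add, ← seq_add, _root_.sub_apply,
        sub_add_cancel, sub_add_cancel, hT]
      funext i
      rcases le_or_gt k i with hi | hi
      · rw [tail_of_le _ hi]
      · rw [tail_of_lt _ hi, Pi.mul_apply]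
        show l i * tail _ k i = 0
        rw [tail_of_lt _ hi, mul_zero]
    refine (hyl k).trans ?_
    rw [h1]
    refine (F.add_le' _ _).trans (add_le_add ?_ ((F.add_le' _ _).trans (add_le_add ?_ le_rfl)))
    · refine (F.mono' _ _ (abs_tail_le _ k)).trans ?_
      rw [← norm_elt_le_iff _ (norm_nonneg _)]
      exact ((T - K).le_opNorm _).trans (mul_le_of_le_one_right (norm_nonneg _) (hy1 k))
    · rw [ofReal_norm_elt]
      exact F.mono' _ _ (abs_tail_le _ k)
  have hzero : Tendsto (fun j => ENNReal.ofReal D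
      + (ENNReal.ofReal ‖K (y (φ j)) - a‖ + F.N (tail a.seq (φ j)))) atTop
      (𝓝 (ENNReal.ofReal D + (ENNReal.ofReal 0 + 0))) := by
    refine tendsto_const_nhds.add ((ENNReal.tendsto_ofReal ?_).add
      ((htail _ a.mem).comp hφ.tendsto_atTop))
    exact tendsto_iff_norm_sub_tendsto_zero.1 hlim
  have := ge_of_tendsto' hzero hbound
  rw [ENNReal.ofReal_zero, add_zero, add_zero,
    ENNReal.ofReal_le_ofReal_iff (norm_nonneg _)] at this
  linarith

theorem essNorm_le {E F : SeqSpace} {T K : E.Elt →L[ℝ] F.Elt} (hK : IsCompactOperator K) :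
    essNorm T ≤ ‖T - K‖ :=
  csInf_le ⟨0, by rintro _ ⟨K, -, rfl⟩; exact norm_nonneg _⟩ ⟨K, hK, rfl⟩

theorem le_essNorm {E F : SeqSpace} {T : E.Elt →L[ℝ] F.Elt} {a : ℝ}
    (h : ∀ K : E.Elt →L[ℝ] F.Elt, IsCompactOperator K → a ≤ ‖T - K‖) : a ≤ essNorm T :=
  le_csInf ⟨_, 0, isCompactOperator_zero, rfl⟩ (by rintro _ ⟨K, hK, rfl⟩; exact h K hK)

/-- The essential norm estimate and the compactness criterion follow once the multipliers from `E`
to `F` are described by the majorants in `M(X, Y)`. -/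
theorem essNorm_and_compactness {X Y E F : SeqSpace} (hX : X.IsRI) (hY : Y.IsRI)
    (hF : CompleteSpace F.Elt) (hs : ∀ n, F.Mem (Pi.single n 1))
    (htail : ∀ z, F.Mem z → Tendsto (fun n => F.N (tail z n)) atTop (𝓝 0))
    {A B : ℝ} (hA0 : 0 < A) (hB0 : 0 < B)
    (hA : ∀ (l : ℕ → ℝ) (b : ℝ≥0∞), b ≠ ∞ → (∀ x, E.Mem x → F.N (l * x) ≤ b * E.N x) →
      Bdd l ∧ multNorm X Y (majorant l) ≤ ENNReal.ofReal A * b)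
    (hB : ∀ l x, Bdd l → multNorm X Y (majorant l) ≠ ∞ → E.Mem x →
      F.N (l * x) ≤ ENNReal.ofReal B * multNorm X Y (majorant l) * E.N x) :
    EssNormEquivalence X Y E F ∧ CompactnessCriterion X Y E F := by
  set M := mult X Y hX.toIsKothe with hM
  have hMs : ∀ k, M.Mem (Pi.single k 1) := fun k => multNorm_single_lt_top hY.toIsKothe k
  have happrox : ∀ (l : ℕ → ℝ) (T : E.Elt →L[ℝ] F.Elt), IsMulOp l T → Bdd l →
      M.N (majorant l) ≠ ∞ → ∀ n, ∃ K : E.Elt →L[ℝ] F.Elt, IsCompactOperator K ∧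
        ‖T - K‖ ≤ B * (2 * (M.N (tail (majorant l) n)).toReal) := by
    intro l T hT hl hlt n
    -- Truncating at `2 * n` leaves a symbol whose majorant is controlled by the tail at `n`.
    obtain ⟨K, hK, hKl⟩ := exists_compact_truncation E hs l (2 * n)
    refine ⟨K, hK, ?_⟩
    have hTK := hT.sub hKl
    rw [sub_truncation] at hTK
    have h1 : M.N (majorant (tail l (2 * n))) ≤ 2 * M.N (tail (majorant l) n) :=
      (mult_isSymm hX hY).N_majorant_tail_le hl n
    have h2 : M.N (tail (majorant l) n) ≠ ∞ :=
      ((M.mono' _ _ (abs_tail_le _ n)).trans_lt (lt_top_iff_ne_top.2 hlt)).ne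
    have h3 : 2 * M.N (tail (majorant l) n) ≠ ∞ := ENNReal.mul_ne_top ENNReal.ofNat_ne_top h2
    refine hTK.opNorm_le (by positivity) fun x hx => ?_
    refine (hB _ x (bdd_tail hl _) (h1.trans_lt (lt_top_iff_ne_top.2 h3)).ne hx).trans ?_
    rw [ENNReal.ofReal_mul hB0.le, ENNReal.ofReal_mul two_pos.le, ENNReal.ofReal_toReal h2,
      ENNReal.ofReal_ofNat]
    exact mul_le_mul_left (mul_le_mul_right h1 _) _
  have hess : ∀ (l : ℕ → ℝ) (T : E.Elt →L[ℝ] F.Elt), IsMulOp l T →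
      Bdd l ∧ M.N (majorant l) ≠ ∞ ∧ ∃ L : ℝ,
        Tendsto (fun n => M.N (tail (majorant l) n)) atTop (𝓝 (ENNReal.ofReal L)) ∧
        essNorm T ≤ B * (2 * L) ∧ L ≤ A * essNorm T := by
    intro l T hT
    obtain ⟨hl, hlA⟩ := hA l _ ENNReal.ofReal_ne_top fun x hx => hT.N_le hx
    have hlt : M.N (majorant l) < ∞ :=
      hlA.trans_lt (ENNReal.mul_lt_top ENNReal.ofReal_lt_top ENNReal.ofReal_lt_top)
    set a : ℕ → ℝ≥0∞ := fun n => M.N (tail (majorant l) n) with ha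
    have haa : Antitone a := fun i j hij => M.mono' _ _ fun k => by
      rcases le_or_gt j k with h | h
      · rw [tail_of_le _ h, tail_of_le _ (hij.trans h)]
      · rw [tail_of_lt _ h, abs_zero]; exact abs_nonneg _
    have hlim := tendsto_atTop_iInf haa
    have hat : ∀ n, a n < ∞ := fun n => (M.mono' _ _ (abs_tail_le _ n)).trans_lt hlt
    have hinf : (⨅ n, a n) ≠ ∞ := ((iInf_le _ 0).trans_lt (hat 0)).ne
    refine ⟨hl, hlt.ne, (⨅ n, a n).toReal, ?_, ?_, ?_⟩
    · rw [ENNReal.ofReal_toReal hinf]; exact hlim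
    · refine ge_of_tendsto' (((ENNReal.tendsto_toReal hinf).comp hlim).const_mul 2 |>.const_mul B)
        fun n => ?_
      obtain ⟨K, hK, hle⟩ := happrox l T hT hl hlt.ne n
      exact (essNorm_le hK).trans hle
    · rw [← div_le_iff₀' hA0]
      refine le_essNorm fun K hK => ?_
      rw [div_le_iff₀' hA0]
      refine le_of_forall_pos_le_add fun ε hε => ?_
      obtain ⟨n, hn⟩ := exists_tail_N_le htail hT hK (div_pos hε hA0)
      have h1 := (hA _ _ ENNReal.ofReal_ne_top hn).2
      have h2 : (⨅ n, a n) ≤ ENNReal.ofReal (A * (‖T - K‖ + ε / A)) := by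
        rw [ENNReal.ofReal_mul hA0.le]
        exact (iInf_le _ n).trans ((M.N_le_of_abs_le (abs_tail_majorant_le hl n)).trans h1)
      refine (ENNReal.toReal_le_of_le_ofReal (by positivity) h2).trans (le_of_eq ?_)
      field_simp
  constructor
  · refine ⟨(B * 2)⁻¹, A, by positivity, hA0, fun l T hT => ?_⟩
    obtain ⟨hl, hlt, L, hL, h1, h2⟩ := hess l T hT
    refine ⟨hl, multMem_of_multNorm_lt_top (lt_top_iff_ne_top.2 hlt), L, hL, ?_, h2⟩
    rw [inv_mul_le_iff₀ (by positivity), mul_assoc]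
    exact h1
  · intro l
    constructor
    · rintro ⟨T, hT, hTc⟩
      obtain ⟨hl, hlt, L, hL, -, h2⟩ := hess l T hT
      refine ⟨hl, multMem_of_multNorm_lt_top (lt_top_iff_ne_top.2 hlt), ?_⟩
      refine (isOCElement_iff_tendsto_tail (Z := M) hMs _).2 ?_
      have h0 : essNorm T ≤ 0 := by simpa using essNorm_le (T := T) hTc
      have hL0 : L ≤ 0 := h2.trans (mul_nonpos_of_nonneg_of_nonpos hA0.le h0)
      rwa [ENNReal.ofReal_of_nonpos hL0] at hL
    · rintro ⟨hl, -, hoc⟩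
      have htl := (isOCElement_iff_tendsto_tail (Z := M) hMs _).1 hoc
      -- Order continuity makes some tail finite in norm, and the remaining head is finitely
      -- supported.
      have hlt : M.N (majorant l) ≠ ∞ := by
        obtain ⟨n, hn⟩ := (ENNReal.tendsto_nhds_zero.1 htl 1 one_pos).exists
        rw [← truncation_add_tail (majorant l) n]
        refine ((M.add_le' _ _).trans_lt (ENNReal.add_lt_top.2
          ⟨M.mem_of_support hMs (indicator_Iio_of_le _ n), hn.trans_lt ENNReal.one_lt_top⟩)).ne
      obtain ⟨T, hT⟩ := exists_isMulOp (E := E) (F := F) (l := l)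
        (b := B * (M.N (majorant l)).toReal) (by positivity) fun x hx => by
          rw [ENNReal.ofReal_mul hB0.le, ENNReal.ofReal_toReal hlt]
          exact hB l x hl hlt hx
      refine ⟨T, hT, ?_⟩
      choose K hK hle using happrox l T hT hl hlt
      refine isCompactOperator_of_tendsto (F := K) (l := atTop) ?_ (Eventually.of_forall hK)
      rw [tendsto_iff_norm_sub_tendsto_zero]
      have h3 : Tendsto (fun n => B * (2 * (M.N (tail (majorant l) n)).toReal)) atTop (𝓝 0) := by
        simpa using ((ENNReal.tendsto_toReal ENNReal.zero_ne_top).comp htl).const_mul 2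
          |>.const_mul B
      refine squeeze_zero (fun _ => norm_nonneg _) (fun n => ?_) h3
      rw [norm_sub_rev]
      exact hle n

/-! ### Tandori spaces -/

theorem tandori_N {Y : SeqSpace} {x : ℕ → ℝ} (hx : Bdd x) : Y.tandori.N x = Y.N (majorant x) :=
  if_pos hx

theorem bdd_of_tandori_mem {Y : SeqSpace} {x : ℕ → ℝ} (hx : Y.tandori.Mem x) : Bdd x := by
  by_contra h
  have : Y.tandori.N x = ∞ := if_neg h
  exact hx.ne this

theorem tendsto_majorant_of_support {m : ℕ} {x : ℕ → ℕ → ℝ} {y : ℕ → ℝ}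
    (hx : ∀ j k, m ≤ k → x j k = 0) (hy : ∀ k, m ≤ k → y k = 0)
    (h : ∀ k, Tendsto (fun j => x j k) atTop (𝓝 (y k))) (n : ℕ) :
    Tendsto (fun j => majorant (x j) n) atTop (𝓝 (majorant y n)) := by
  refine tendsto_order.2 ⟨fun a ha => ?_, fun a ha => ?_⟩
  · obtain ⟨k, hk, hky⟩ := exists_abs_eq_majorant hy n
    rw [← hky] at ha
    filter_upwards [(h k).abs.eventually (lt_mem_nhds ha)] with j hj
    exact hj.trans_le (abs_le_majorant_of_le (bdd_of_support (hx j)) hk)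
  · have hev : ∀ᶠ j in atTop, ∀ k ∈ Finset.range m, n ≤ k → |x j k| < a := by
      refine (Finset.eventually_all _).2 fun k _ => ?_
      by_cases hk : n ≤ k
      · filter_upwards [(h k).abs.eventually (gt_mem_nhds
          ((abs_le_majorant_of_le (bdd_of_support hy) hk).trans_lt ha))] with j hj _ using hj
      · exact Eventually.of_forall fun j h => absurd h hk
    filter_upwards [hev] with j hj
    obtain ⟨k, hk, hkx⟩ := exists_abs_eq_majorant (hx j) n
    rw [← hkx]
    rcases lt_or_ge k m with hkm | hkm
    · exact hj k (Finset.mem_range.2 hkm) hk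
    · rw [hx j k hkm, abs_zero]
      exact (majorant_nonneg y n).trans_lt ha

theorem tandori_single_mem {Y : SeqSpace} (hY : Y.IsKothe) (n : ℕ) :
    Y.tandori.Mem (Pi.single n 1) := by
  have h : ∀ k, n + 1 ≤ k → (Pi.single n 1 : ℕ → ℝ) k = 0 := fun k hk => by
    rw [Pi.single_apply, if_neg (by omega)]
  rw [Mem, tandori_N (bdd_of_support h)]
  exact Y.mem_of_support hY.single_mem fun k hk => majorant_of_support h hk

theorem tandori_complete {Y : SeqSpace} (hY : Y.IsKothe) (hYF : Y.HasFatou) :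
    CompleteSpace Y.tandori.Elt := by
  refine completeSpace_of_fatou fun x y B hB hx hxy => ?_
  have hxb : ∀ k, Bdd (x k) := fun k => bdd_of_tandori_mem ((hx k).trans_lt hB.lt_top)
  have hxN : ∀ k, Y.N (majorant (x k)) ≤ B := fun k => tandori_N (hxb k) ▸ hx k
  have hyb : Bdd y := by
    set D := B / Y.N (Pi.single 0 1) with hD
    have hDt : D ≠ ∞ := ENNReal.div_ne_top hB (Y.N_single_ne_zero 0)
    refine ⟨D.toReal, ?_⟩
    rintro _ ⟨n, rfl⟩
    refine le_of_tendsto' (hxy n).abs fun k => ?_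
    refine (abs_le_majorant_of_le (hxb k) (Nat.zero_le n)).trans ((le_abs_self _).trans ?_)
    have h1 := ENNReal.toReal_mono hDt ((ENNReal.le_div_iff_mul_le
      (Or.inl (Y.N_single_ne_zero 0)) (Or.inl (hY.single_mem 0).ne)).2
      ((Y.enorm_mul_N_single_le _ 0).trans (hxN k)))
    rwa [toReal_enorm] at h1
  rw [tandori_N hyb]
  -- Majorants are not continuous for coordinatewise convergence, but on a fixed finite support they
  -- are. Hence two uses of Fatou: first removing the truncation at `m`, then passing to the limit
  -- in `k`.
  refine hYF.le_of_tendsto (fun m => ?_) (tendsto_majorant_truncation hyb)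
  refine hYF.le_of_tendsto (x := fun k => majorant ((Set.Iio m).indicator (x k))) (fun k => ?_)
    (tendsto_majorant_of_support (fun k => indicator_Iio_of_le (x k) m)
      (indicator_Iio_of_le y m) fun n => ?_)
  · refine (Y.N_le_of_abs_le fun n => ?_).trans (hxN k)
    rw [abs_of_nonneg (majorant_nonneg _ _)]
    exact majorant_mono (hxb k) (abs_indicator_le _ _) n
  · by_cases hn : n ∈ Set.Iio m
    · simpa only [Set.indicator_of_mem hn] using hxy n
    · simp only [Set.indicator_of_notMem hn]; exact tendsto_const_nhds

/-- The majorants of the tails at `n` are bounded everywhere by the value of the majorant of `z` at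
`n`, which tends to zero; they decrease, and order continuity of `Y` applies. -/
theorem tandori_tendsto_tail {Y : SeqSpace} (hY : Y.IsRI) (hOC : Y.IsOC) {z : ℕ → ℝ}
    (hz : Y.tandori.Mem z) : Tendsto (fun n => Y.tandori.N (tail z n)) atTop (𝓝 0) := by
  have hb := bdd_of_tandori_mem hz
  have hm : Y.Mem (majorant z) := by rwa [Mem, tandori_N hb] at hz
  simp only [tandori_N (bdd_tail hb _)]
  refine hOC _ hm _ (fun n => majorant_nonneg _) (fun n k => ?_) (fun k i j hij => ?_) fun k => ?_
  · exact (majorant_mono hb (abs_tail_le z n) k).trans (le_abs_self _)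
  · refine majorant_mono (bdd_tail hb i) (fun n => ?_) k
    rcases le_or_gt j n with h | h
    · rw [tail_of_le _ h, tail_of_le _ (hij.trans h)]
    · rw [tail_of_lt _ h, abs_zero]; exact abs_nonneg _
  · refine squeeze_zero (fun n => majorant_nonneg _ _) (fun n => ?_) (hOC.tendsto_zero hY hm)
    refine (majorant_le_iff (bdd_tail hb n)).2 fun j _ => ?_
    rcases le_or_gt n j with h | h
    · rw [tail_of_le _ h]; exact abs_le_majorant_of_le hb h
    · rw [tail_of_lt _ h, abs_zero]; exact majorant_nonneg _ _

theorem tandori_essNorm_and_compactness {X Y : SeqSpace} (hX : X.IsRI) (hY : Y.IsRI)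
    (hYF : Y.HasFatou) (hOC : Y.IsOC) (hfact : Factorizes X Y) :
    EssNormEquivalence X Y X.tandori Y.tandori ∧
      CompactnessCriterion X Y X.tandori Y.tandori := by
  obtain ⟨A, hA0, hA⟩ := exists_multNorm_majorant_le hX hY hYF hfact
  refine essNorm_and_compactness hX hY (tandori_complete hY.toIsKothe hYF)
    (tandori_single_mem hY.toIsKothe) (fun z hz => tandori_tendsto_tail hY hOC hz) hA0 one_pos
    (fun l b hb h => hA l b hb fun k n g hga hg0 hgn => ?_) fun l x hl _ hx => ?_
  · have hgN : X.tandori.N g = X.N g := by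
      rw [tandori_N (bdd_of_antitone hga hg0), majorant_of_antitone hga hg0]
    have hgm : X.tandori.Mem g := by
      rw [Mem, hgN]; exact X.mem_of_support hX.toIsKothe.single_mem hgn
    have hb' : Bdd ((Set.Iio k).indicator l * g) :=
      bdd_of_support (n := n) fun j hj => by simp [hgn j hj]
    rw [← tandori_N hb', ← hgN]
    refine le_trans (Y.tandori.mono' _ _ fun j => ?_) (h g hgm)
    rw [Pi.mul_apply, Pi.mul_apply, abs_mul, abs_mul]
    exact mul_le_mul_of_nonneg_right (abs_indicator_le _ _ _) (abs_nonneg _)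
  · have hxb := bdd_of_tandori_mem hx
    have hxm : X.Mem (majorant x) := by rwa [Mem, tandori_N hxb] at hx
    have hle : ∀ k j, k ≤ j → |(l * x) j| ≤ majorant l k * majorant x k := fun k j hkj => by
      rw [Pi.mul_apply, abs_mul]
      exact mul_le_mul (abs_le_majorant_of_le hl hkj) (abs_le_majorant_of_le hxb hkj)
        (abs_nonneg _) (majorant_nonneg _ _)
    have hlx : Bdd (l * x) := ⟨majorant l 0 * majorant x 0, by
      rintro _ ⟨j, rfl⟩; exact hle 0 j (Nat.zero_le j)⟩
    rw [tandori_N hlx, tandori_N hxb, ENNReal.ofReal_one, one_mul]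
    refine le_trans (Y.N_le_of_abs_le fun k => ?_) (N_mul_le_multNorm X Y (majorant l) hxm)
    rw [abs_of_nonneg (majorant_nonneg _ _)]
    exact (majorant_le_iff hlx).2 (hle k)

/-! ### Cesàro spaces -/

theorem tendsto_hardy {x : ℕ → ℕ → ℝ} {y : ℕ → ℝ}
    (h : ∀ n, Tendsto (fun k => x k n) atTop (𝓝 (y n))) (n : ℕ) :
    Tendsto (fun k => hardy (x k) n) atTop (𝓝 (hardy y n)) :=
  (tendsto_finsetSum _ fun i _ => h i).div_const _

theorem cesaro_mem_of_support {Y : SeqSpace} (hY : Y.IsKothe) (hH : Y.HardyBounded) {n : ℕ}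
    {x : ℕ → ℝ} (hx : ∀ k, n ≤ k → x k = 0) : Y.cesaro.Mem x := by
  obtain ⟨K, -, hK⟩ := hH
  have hm : Y.Mem fun k => |x k| :=
    Y.mem_of_support hY.single_mem (n := n) fun k hk => by rw [hx k hk, abs_zero]
  exact (hK _ hm).trans_lt (ENNReal.mul_lt_top ENNReal.ofReal_lt_top hm)

theorem cesaro_complete {Y : SeqSpace} (hYF : Y.HasFatou) : CompleteSpace Y.cesaro.Elt :=
  completeSpace_of_fatou fun _ _ _ _ hx hxy =>
    hYF.le_of_tendsto hx (tendsto_hardy fun n => (hxy n).abs)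

theorem cesaro_tendsto_tail {Y : SeqSpace} (hOC : Y.IsOC) {z : ℕ → ℝ}
    (hz : Y.cesaro.Mem z) : Tendsto (fun n => Y.cesaro.N (tail z n)) atTop (𝓝 0) := by
  refine hOC _ hz (fun n => hardy fun k => |tail z n k|)
    (fun n => hardy_nonneg fun k => abs_nonneg _) (fun n k => ?_) (fun k i j hij => ?_) fun k => ?_
  · exact (hardy_mono (abs_tail_le z n) k).trans (le_abs_self _)
  · refine hardy_mono (fun n => ?_) k
    rcases le_or_gt j n with h | h
    · rw [tail_of_le _ h, tail_of_le _ (hij.trans h)]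
    · rw [tail_of_lt _ h, abs_zero]; exact abs_nonneg _
  · have h0 : hardy (fun _ => (0 : ℝ)) k = 0 := by simp [hardy]
    rw [← h0]
    refine tendsto_hardy (fun i => tendsto_const_nhds.congr' ?_) k
    filter_upwards [eventually_gt_atTop i] with n hn
    rw [tail_of_lt _ hn, abs_zero]

/-- Abel's inequality: a decreasing weight preserves the order of partial sums. -/
theorem sum_antitone_mul_le {u w z : ℕ → ℝ} (hu : Antitone u) (hu0 : ∀ n, 0 ≤ u n)
    (h : ∀ n, ∑ k ∈ Finset.range (n + 1), w k ≤ ∑ k ∈ Finset.range (n + 1), z k) (n : ℕ) :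
    ∑ k ∈ Finset.range (n + 1), u k * w k ≤ ∑ k ∈ Finset.range (n + 1), u k * z k := by
  -- Keeping the last weight times the nonnegative partial sum on the left makes the induction
  -- close.
  have key : ∀ n, u n * ∑ k ∈ Finset.range (n + 1), (z k - w k)
      ≤ ∑ k ∈ Finset.range (n + 1), u k * (z k - w k) := by
    intro n
    induction n with
    | zero => simp
    | succ n ih =>
      rw [Finset.sum_range_succ, Finset.sum_range_succ (fun k => u k * (z k - w k)), mul_add]
      refine add_le_add (le_trans ?_ ih) le_rfl
      refine mul_le_mul_of_nonneg_right (hu (Nat.le_succ n)) ?_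
      rw [Finset.sum_sub_distrib]
      linarith [h n]
  have h1 := key n
  have h2 : 0 ≤ u n * ∑ k ∈ Finset.range (n + 1), (z k - w k) := by
    refine mul_nonneg (hu0 n) ?_
    rw [Finset.sum_sub_distrib]
    linarith [h n]
  simp only [mul_sub, Finset.sum_sub_distrib] at h1 h2
  linarith

theorem sum_range_two_mul' (f : ℕ → ℝ) (n : ℕ) :
    ∑ k ∈ Finset.range n, (f (2 * k) + f (2 * k + 1)) = ∑ k ∈ Finset.range (2 * n), f k := by
  induction n with
  | zero => simp
  | succ n ih =>
    rw [Finset.sum_range_succ, ih, show 2 * (n + 1) = 2 * n + 1 + 1 by ring,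
      Finset.sum_range_succ _ (2 * n + 1), Finset.sum_range_succ _ (2 * n), add_assoc]

/-- For the `n + 2` indices `n ≤ k < 2 * (n + 1)` the mean is at least the partial sum up to `n`
divided by `2 * (n + 1)`. Pairing even and odd indices fits them into the first `n + 1` terms, and
the factor `2` restores the full sum. -/
theorem sum_le_sum_hardy {w : ℕ → ℝ} (hw : ∀ n, 0 ≤ w n) (n : ℕ) :
    ∑ k ∈ Finset.range (n + 1), w k
      ≤ ∑ k ∈ Finset.range (n + 1), 2 * (hardy w (2 * k) + hardy w (2 * k + 1)) := by
  set S := ∑ k ∈ Finset.range (n + 1), w k with hS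
  have hS0 : 0 ≤ S := Finset.sum_nonneg fun k _ => hw k
  rw [← Finset.mul_sum, sum_range_two_mul']
  have h1 : ∑ _k ∈ Finset.Ico n (2 * (n + 1)), S / (2 * (n + 1))
      ≤ ∑ k ∈ Finset.range (2 * (n + 1)), hardy w k := by
    refine le_trans (Finset.sum_le_sum fun k hk => ?_) (Finset.sum_le_sum_of_subset_of_nonneg
      (fun k hk => Finset.mem_range.2 (Finset.mem_Ico.1 hk).2) fun k _ _ => hardy_nonneg hw k)
    obtain ⟨hk1, hk2⟩ := Finset.mem_Ico.1 hk
    have h2 : S ≤ ∑ j ∈ Finset.range (k + 1), w j :=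
      Finset.sum_le_sum_of_subset_of_nonneg (Finset.range_mono (by omega)) fun j _ _ => hw j
    have h3 : (k : ℝ) + 1 ≤ 2 * (n + 1) := by exact_mod_cast hk2
    unfold hardy
    exact div_le_div₀ (hS0.trans h2) h2 (by positivity) h3
  rw [Finset.sum_const, Nat.card_Ico, nsmul_eq_mul, Nat.cast_sub (by omega)] at h1
  refine le_trans ?_ (mul_le_mul_of_nonneg_left h1 two_pos.le)
  push_cast
  rw [show 2 * ((2 * ((n : ℝ) + 1) - n) * (S / (2 * (n + 1)))) = S * ((n + 2) / (n + 1)) by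
    field_simp; ring]
  refine le_mul_of_one_le_right hS0 ?_
  rw [one_le_div (by positivity)]
  linarith

/-- The Hardy operator maps products with a decreasing multiplier from `CX` to `Y`. -/
theorem cesaro_mul_le {X Y : SeqSpace} (hX : X.IsRI) {K : ℝ}
    (hK : ∀ x, Y.Mem x → Y.N (hardy x) ≤ ENNReal.ofReal K * Y.N x) {l x : ℕ → ℝ} (hl : Bdd l)
    (hlt : multNorm X Y (majorant l) ≠ ∞) (hx : X.cesaro.Mem x) :
    Y.cesaro.N (l * x) ≤ ENNReal.ofReal (4 * K) * multNorm X Y (majorant l) * X.cesaro.N x := by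
  set h := hardy fun k => |x k| with hh
  have hh0 : ∀ n, 0 ≤ h n := hardy_nonneg fun k => abs_nonneg _
  -- `z` replaces `|x|` in the partial sums yet lies in `X` itself: it is twice a sum of two
  -- injective reindexings of the means, whence the constant `4`.
  set z : ℕ → ℝ := (2 : ℝ) • (h ∘ (fun k => 2 * k) + h ∘ fun k => 2 * k + 1) with hz
  have hzN : X.N z ≤ 4 * X.cesaro.N x := by
    rw [hz, X.smul', show (4 : ℝ≥0∞) = 2 * 2 by norm_num, mul_assoc]
    have h2 : ‖(2 : ℝ)‖ₑ = 2 := by simp [Real.enorm_eq_ofReal]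
    rw [h2]
    refine mul_le_mul_right ((X.add_le' _ _).trans ?_) _
    rw [two_mul]
    exact add_le_add (hX.isSymm _ (fun a b hab => by simpa using hab) h)
      (hX.isSymm _ (fun a b hab => by simpa using hab) h)
  have hzm : X.Mem z := hzN.trans_lt (ENNReal.mul_lt_top (by simp) hx)
  have h1 : Y.cesaro.N (l * x) ≤ Y.N (hardy (majorant l * z)) := by
    refine Y.N_le_of_abs_le fun n => ?_
    rw [abs_of_nonneg (hardy_nonneg (fun k => abs_nonneg _) n)]
    refine (hardy_mono (y := fun k => majorant l k * |x k|) (fun k => ?_) n).trans ?_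
    · rw [Pi.mul_apply, abs_mul]
      exact mul_le_mul_of_nonneg_right (le_majorant hl k) (abs_nonneg _)
    · refine div_le_div_of_nonneg_right ?_ (by positivity)
      exact sum_antitone_mul_le (majorant_antitone hl) (majorant_nonneg l)
        (sum_le_sum_hardy fun k => abs_nonneg _) n
  have h2 := N_mul_le_multNorm X Y (majorant l) hzm
  have h3 := hK _ (h2.trans_lt (ENNReal.mul_lt_top hlt.lt_top hzm))
  refine h1.trans (h3.trans ?_)
  rw [ENNReal.ofReal_mul (by norm_num), ENNReal.ofReal_ofNat]
  calc ENNReal.ofReal K * Y.N (majorant l * z)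
      ≤ ENNReal.ofReal K * (multNorm X Y (majorant l) * (4 * X.cesaro.N x)) :=
        mul_le_mul_right (h2.trans (mul_le_mul_right hzN _)) _
    _ = _ := by ring

/-- A decreasing sequence is dominated in norm by a sequence whose distribution function is
larger. -/
theorem IsSymm.N_le_of_card {Y : SeqSpace} (hY : Y.IsSymm) {p q : ℕ → ℝ} {n : ℕ}
    (hp0 : ∀ i, 0 ≤ p i) (hq0 : ∀ i, 0 ≤ q i)
    (h : ∀ i, 0 < p i → ∃ s : Finset ℕ, s ⊆ Finset.range n ∧ i < s.card ∧ ∀ j ∈ s, p i ≤ q j) :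
    Y.N p ≤ Y.N q := by
  set Q : Fin n → ℝ := fun i => q i with hQ
  -- At least `i + 1` of the first `n` values of `q` are at least `p i`, so the decreasing
  -- arrangement of these values dominates `p` pointwise.
  obtain ⟨σ, hσ⟩ := exists_antitone_comp_perm Q
  have h1 : Y.N p ≤ Y.N (extZero (Q ∘ σ)) := by
    refine Y.N_le_of_abs_le fun i => ?_
    rw [abs_of_nonneg (hp0 i)]
    rcases (hp0 i).eq_or_lt with h0 | h0
    · rw [← h0]; exact extZero_forall le_rfl (fun j => hq0 _) i
    obtain ⟨s, hs, hi, hsq⟩ := h i h0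
    have hin : i < n := hi.trans_le ((Finset.card_le_card hs).trans (Finset.card_range n).le)
    rw [extZero_of_lt _ hin]
    refine (Tuple.lt_card_ge_iff_apply_ge_of_antitone (j := ⟨i, hin⟩) (a := p i) hσ).1
      (hi.trans_le ?_)
    refine Finset.card_le_card_of_injOn
      (fun j => if hj : j < n then σ.symm ⟨j, hj⟩ else ⟨i, hin⟩) (fun j hj => ?_) ?_
    · have hjn : j < n := Finset.mem_range.1 (hs hj)
      simp only [hjn, dif_pos, Finset.coe_filter, Finset.mem_univ, true_and, Set.mem_ofPred_eq,
        Function.comp_apply, Equiv.apply_symm_apply]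
      exact hsq j hj
    · intro j hj k hk hjk
      have hjn : j < n := Finset.mem_range.1 (hs hj)
      have hkn : k < n := Finset.mem_range.1 (hs hk)
      simp only [hjn, hkn, dif_pos, EmbeddingLike.apply_eq_iff_eq, Fin.mk.injEq] at hjk
      exact hjk
  refine h1.trans ((hY.N_extZero_comp_perm σ Q).trans (Y.mono' _ _ fun k => ?_))
  rcases lt_or_ge k n with hk | hk
  · rw [extZero_of_lt _ hk]
  · rw [extZero_of_le _ hk, abs_zero]; exact abs_nonneg _

/-- Moving the mass of a decreasing sequence to the places where a product attains its majorant
does not increase the means, but keeps the norm of the means of the product large. -/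
theorem exists_moved_mass {Y : SeqSpace} (hY : Y.IsSymm) {l g : ℕ → ℝ} {m : ℕ} (hg : Antitone g)
    (hg0 : ∀ k, 0 ≤ g k) (hgm : ∀ k, m ≤ k → g k = 0) :
    ∃ x : ℕ → ℝ, (∀ k, 0 ≤ x k) ∧ (∀ k, m ≤ k → x k = 0) ∧ (∀ n, hardy x n ≤ hardy g n) ∧
      Y.N (majorant (l * g)) ≤ 2 * Y.N (hardy fun k => |(l * x) k|) := by
  classical
  set a := l * g with ha
  have ham : ∀ k, m ≤ k → a k = 0 := fun k hk => by simp [ha, hgm k hk]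
  have hab := bdd_of_support ham
  set p := majorant a with hp
  have hex : ∀ i, ∃ j, i ≤ j ∧ |a j| = p j := fun i =>
    ⟨max i m, le_max_left _ _, by
      rw [ham _ (le_max_right _ _), hp, majorant_of_support ham (le_max_right _ _), abs_zero]⟩
  -- The first place from `i` on where `|a|` equals its own majorant; the majorant is constant from
  -- `i` up to `e i`.
  set e : ℕ → ℕ := fun i => Nat.find (hex i) with he
  have hie : ∀ i, i ≤ e i := fun i => (Nat.find_spec (hex i)).1
  have hae : ∀ i, |a (e i)| = p (e i) := fun i => (Nat.find_spec (hex i)).2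
  have hmin : ∀ i j, i ≤ j → |a j| = p j → e i ≤ j := fun i j h1 h2 => Nat.find_min' _ ⟨h1, h2⟩
  have hpa : Antitone p := majorant_antitone hab
  have hpe : ∀ i, p (e i) = p i := fun i => by
    refine le_antisymm (hpa (hie i)) ?_
    obtain ⟨j, hij, hj⟩ := exists_abs_eq_majorant ham i
    have hjj : |a j| = p j :=
      le_antisymm (abs_le_majorant_of_le hab le_rfl) (hj.ge.trans' (hpa hij))
    have h1 : p i = p j := hj.symm.trans hjj
    rw [h1]
    exact hpa (hmin i j hij hjj)
  -- `c k` counts the indices `i < m` sent to `k`. In `g * c` each index `i` contributes `g (e i) ≤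
  -- g i`, and later than in `g`, so the means do not grow.
  set c : ℕ → ℝ := fun k => ∑ i ∈ Finset.range m, if e i = k then 1 else 0 with hc
  have hc0 : ∀ k, 0 ≤ c k := fun k => Finset.sum_nonneg fun i _ => by split_ifs <;> simp
  have hsum : ∀ (f : ℕ → ℝ) n, ∑ k ∈ Finset.range (n + 1), f k * c k
      = ∑ i ∈ Finset.range m, if e i < n + 1 then f (e i) else 0 := fun f n => by
    simp only [hc, Finset.mul_sum, mul_ite, mul_one, mul_zero]
    rw [Finset.sum_comm]
    refine Finset.sum_congr rfl fun i _ => ?_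
    rw [Finset.sum_ite_eq]
    simp only [Finset.mem_range]
  have hsub : ∀ (f : ℕ → ℝ) n, ∑ i ∈ Finset.range m, (if i < n + 1 then f i else 0)
      = ∑ i ∈ Finset.range m ∩ Finset.range (n + 1), f i := fun f n => by
    rw [← Finset.sum_filter]
    refine Finset.sum_congr ?_ fun _ _ => rfl
    ext i; simp
  refine ⟨g * c, fun k => mul_nonneg (hg0 k) (hc0 k), fun k hk => by simp [hgm k hk],
    fun n => div_le_div_of_nonneg_right ?_ (by positivity), ?_⟩
  · calc ∑ k ∈ Finset.range (n + 1), (g * c) k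
        = ∑ i ∈ Finset.range m, if e i < n + 1 then g (e i) else 0 := hsum g n
      _ ≤ ∑ i ∈ Finset.range m, if i < n + 1 then g i else 0 := by
          refine Finset.sum_le_sum fun i _ => ?_
          split_ifs with h1 h2 h2
          · exact hg (hie i)
          · exact absurd ((hie i).trans_lt h1) h2
          · exact hg0 i
          · exact le_rfl
      _ ≤ ∑ k ∈ Finset.range (n + 1), g k := by
          rw [hsub]
          exact Finset.sum_le_sum_of_subset_of_nonneg Finset.inter_subset_right fun i _ _ => hg0 i
  · set q := hardy fun k => |(l * (g * c)) k| with hq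
    have hq0 : ∀ n, 0 ≤ q n := hardy_nonneg fun k => abs_nonneg _
    -- All `e i + 1` indices up to `e i` are moved to places at most `e i`, each carrying a value of
    -- at least `p i`; dividing by `j + 1 ≤ 2 * (e i + 1)` costs the factor `2`.
    have hqp : ∀ i, 0 < p i → ∀ j, e i ≤ j → j ≤ 2 * e i + 1 → p i ≤ 2 * q j := by
      intro i hi j hj1 hj2
      have hem : e i < m := by
        by_contra h
        have := majorant_of_support ham (not_lt.1 h)
        rw [← hp, hpe] at this
        exact hi.ne' this
      have h1 : (e i + 1) * p i ≤ ∑ k ∈ Finset.range (j + 1), |(l * (g * c)) k| := by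
        calc ((e i : ℝ) + 1) * p i = ∑ _k ∈ Finset.range (e i + 1), p i := by
              rw [Finset.sum_const, Finset.card_range, nsmul_eq_mul]; push_cast; ring
          _ ≤ ∑ k ∈ Finset.range (e i + 1), p k := Finset.sum_le_sum fun k hk => by
              rw [← hpe i]; exact hpa (Nat.lt_succ_iff.1 (Finset.mem_range.1 hk))
          _ = ∑ k ∈ Finset.range m, if k < e i + 1 then p k else 0 := by
              rw [hsub, Finset.inter_eq_right.2 (Finset.range_mono hem)]
          _ ≤ ∑ k ∈ Finset.range m, if e k < j + 1 then |a (e k)| else 0 := by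
              refine Finset.sum_le_sum fun k _ => ?_
              split_ifs with h1 h2 h2
              · rw [hae, hpe]
              · exact absurd (Nat.lt_succ_of_le
                  ((hmin k (e i) (Nat.lt_succ_iff.1 h1) (hae i)).trans hj1)) h2
              · exact abs_nonneg _
              · exact le_rfl
          _ = ∑ k ∈ Finset.range (j + 1), |(l * (g * c)) k| := by
              rw [← hsum fun k => |a k|]
              refine Finset.sum_congr rfl fun k _ => ?_
              rw [← mul_assoc, ← ha, Pi.mul_apply, abs_mul, abs_of_nonneg (hc0 k)]
      have h2 : (j : ℝ) + 1 ≤ 2 * (e i + 1) := by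
        have : j + 1 ≤ 2 * (e i + 1) := by omega
        exact_mod_cast this
      rw [hq, hardy, mul_div_assoc', le_div_iff₀ (by positivity)]
      nlinarith
    have h2N : 2 * Y.N q = Y.N ((2 : ℝ) • q) := by
      rw [Y.smul']
      congr 1
      simp [Real.enorm_eq_ofReal]
    rw [h2N]
    refine hY.N_le_of_card (n := 2 * m + 2) (majorant_nonneg a)
      (fun i => mul_nonneg two_pos.le (hq0 i)) fun i hi => ?_
    have hem : e i < m := by
      by_contra h
      have := majorant_of_support ham (not_lt.1 h)
      rw [← hp, hpe] at this
      exact hi.ne' this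
    -- This interval has `e i + 2` elements, more than `i`.
    refine ⟨Finset.Icc (e i) (2 * e i + 1), fun j hj => ?_, ?_, fun j hj => ?_⟩
    · have := (Finset.mem_Icc.1 hj).2
      exact Finset.mem_range.2 (by omega)
    · rw [Nat.card_Icc]
      have := hie i
      omega
    · exact hqp i hi j (Finset.mem_Icc.1 hj).1 (Finset.mem_Icc.1 hj).2

theorem cesaro_essNorm_and_compactness {X Y : SeqSpace} (hX : X.IsRI) (hY : Y.IsRI)
    (hYF : Y.HasFatou) (hOC : Y.IsOC) (hfact : Factorizes X Y) (hXH : X.HardyBounded)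
    (hYH : Y.HardyBounded) :
    EssNormEquivalence X Y X.cesaro Y.cesaro ∧ CompactnessCriterion X Y X.cesaro Y.cesaro := by
  obtain ⟨A, hA0, hA⟩ := exists_multNorm_majorant_le hX hY hYF hfact
  obtain ⟨K, hK0, hK⟩ := hXH
  obtain ⟨K', hK'0, hK'⟩ := id hYH
  -- The summands `1` only keep the constants positive, as the Hardy bounds are merely nonnegative.
  refine essNorm_and_compactness hX hY (cesaro_complete hYF) (A := A * (2 * K + 1))
    (B := 4 * K' + 1)
    (fun n => cesaro_mem_of_support hY.toIsKothe hYH (n := n + 1) fun k hk => by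
      rw [Pi.single_apply, if_neg (by omega)])
    (fun z hz => cesaro_tendsto_tail hOC hz) (by positivity) (by positivity)
    (fun l b hb h => ?_) fun l x hl hlt hx => ?_
  · rw [ENNReal.ofReal_mul hA0.le, mul_assoc]
    refine hA l _ (ENNReal.mul_ne_top ENNReal.ofReal_ne_top hb) fun k n g hga hg0 hgn => ?_
    obtain ⟨x, hx0, hxn, hxg, hle⟩ :=
      exists_moved_mass hY.isSymm (l := (Set.Iio k).indicator l) hga hg0 hgn
    have hgm : X.Mem g := X.mem_of_support hX.toIsKothe.single_mem hgn
    have hxN : X.cesaro.N x ≤ ENNReal.ofReal K * X.N g := by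
      refine le_trans (X.mono' _ _ fun j => ?_) (hK g hgm)
      have : (fun k => |x k|) = x := funext fun k => abs_of_nonneg (hx0 k)
      rw [this]
      exact abs_le_abs_of_nonneg (hardy_nonneg hx0 j) (hxg j)
    have hxm : X.cesaro.Mem x :=
      hxN.trans_lt (ENNReal.mul_lt_top ENNReal.ofReal_lt_top hgm)
    have h1 : Y.cesaro.N ((Set.Iio k).indicator l * x) ≤ b * X.cesaro.N x := by
      refine le_trans (Y.cesaro.mono' _ _ fun j => ?_) (h x hxm)
      rw [Pi.mul_apply, Pi.mul_apply, abs_mul, abs_mul]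
      exact mul_le_mul_of_nonneg_right (abs_indicator_le _ _ _) (abs_nonneg _)
    calc Y.N (majorant ((Set.Iio k).indicator l * g))
        ≤ 2 * (b * (ENNReal.ofReal K * X.N g)) :=
          hle.trans (mul_le_mul_right (h1.trans (mul_le_mul_right hxN _)) _)
      _ = ENNReal.ofReal (2 * K) * b * X.N g := by
          rw [ENNReal.ofReal_mul two_pos.le, ENNReal.ofReal_ofNat]; ring
      _ ≤ ENNReal.ofReal (2 * K + 1) * b * X.N g := by
          gcongr; linarith
  · refine (cesaro_mul_le hX hK' hl hlt hx).trans ?_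
    gcongr
    linarith

end SeqSpace

theorem mainTheorem7 (X Y : SeqSpace) (hX : X.IsRI) (hY : Y.IsRI)
    (hXF : X.HasFatou) (hYF : Y.HasFatou) (hXY : X.IsOC ∨ Y.IsReflexive)
    (hfact : SeqSpace.Factorizes X Y) :
    (SeqSpace.EssNormEquivalence X Y X.tandori Y.tandori ∧
      SeqSpace.CompactnessCriterion X Y X.tandori Y.tandori) ∧
    (X.HardyBounded → Y.HardyBounded →
      SeqSpace.EssNormEquivalence X Y X.cesaro Y.cesaro ∧
      SeqSpace.CompactnessCriterion X Y X.cesaro Y.cesaro) := by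
  -- Both alternatives enter only through order continuity of `Y`.
  have hOC : Y.IsOC := hXY.elim hfact.isOC SeqSpace.IsReflexive.isOC
  exact ⟨SeqSpace.tandori_essNorm_and_compactness hX hY hYF hOC hfact,
    SeqSpace.cesaro_essNorm_and_compactness hX hY hYF hOC hfact⟩
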